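/- A hypergraph $H=(V,\mathcal E)$ consists of a finite vertex set $V$ and a finite family (repetitions allowed) $\mathcal E$ of subsets of $V$. It is a hypertree if there is a tree $T$ with vertex set $V$ such that $T[e]$ is connected for every $e\in\mathcal E$ (empty hyperedges are allowed and impose no condition). Its $2$-section $2sec(H)$ is the graph on $V$ in which two distinct vertices are adjacent if and only if they lie in a common hyperedge. For a graph $G$ let $N[v]$ be the closed neighbourhood of $v$. A set $D$ of vertices of $G$ is an efficient dominating set of $G$ if for every vertex $v$ there is exactly one $d\in D$ with $v\in N[d]$; an efficient dominating set of $H$ is an efficient dominating set of $2sec(H)$. A graph $G$ is dually chordal if its vertices can be ordered as $v_1,\dots,v_n$ such that for every $i$, in the induced subgraph $G_i=G[\{v_i,\dots,v_n\}]$, there is a vertex $u\in N_{G_i}[v_i]$ with $N_{G_i}[w]\subseteq N_{G_i}[u]$ for all $w\in N_{G_i}[v_i]$. Then the following hold. (1) For every hypertree $H$, the graph $2sec(H)$ is dually chordal. (2) The efficient domination (ED) problem for hypertrees is solvable in polynomial time: there are a deterministic multi-stack Turing machine $M$ and a polynomial $p$ such that for every hypertree $H$ with vertex set $\{0,\dots,n-1\}$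 and hyperedges listed as $e_1,\dots,e_m$, given as a word $x$ over $\{0,1,\#\}$ ($n$ in unary followed by $\#$, then for each hyperedge its characteristic vector of $n$ bits followed by $\#$), $M$ halts on $x$ after at most $p(|x|)$ steps and answers correctly whether $H$ has an efficient dominating set. -/

import Mathlib

namespace HypertreeED

/-! ### Graphs -/

/-- The closed neighbourhood `N[v]` of a vertex `v`. -/
def closedNbhd {V : Type*} (G : SimpleGraph V) (v : V) : Set V :=
  {u | u = v ∨ G.Adj v u}

/-- `D` is an efficient dominating set of `G`: every vertex lies in the closed neighbourhood
of exactly one element of `D`. -/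
def IsEfficientDominating {V : Type*} (G : SimpleGraph V) (D : Set V) : Prop :=
  ∀ v : V, ∃! d : V, d ∈ D ∧ v ∈ closedNbhd G d

/-- `u` is a maximum neighbour of `v` in `G`. -/
def IsMaximumNeighbor {V : Type*} (G : SimpleGraph V) (v u : V) : Prop :=
  u ∈ closedNbhd G v ∧ ∀ w ∈ closedNbhd G v, closedNbhd G w ⊆ closedNbhd G u

/-- `G` is dually chordal: its vertices can be ordered as `σ 0, σ 1, …` in such a way that each
`σ i` has a maximum neighbour in the subgraph induced by `{σ j | i ≤ j}`
(a maximum neighbourhood ordering). -/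
def IsDuallyChordal {V : Type*} [Fintype V] (G : SimpleGraph V) : Prop :=
  ∃ σ : Fin (Fintype.card V) ≃ V, ∀ i : Fin (Fintype.card V),
    ∃ u : {x : V // i ≤ σ.symm x},
      IsMaximumNeighbor (G.induce {x : V | i ≤ σ.symm x}) ⟨σ i, by simp⟩ u

/-! ### Hypergraphs -/

/-- A hypergraph on the vertex set `V`: a finite family of finite subsets of `V`, repetitions
allowed. -/
structure MultiHypergraph (V : Type*) where
  /-- the hyperedges -/
  edges : Multiset (Finset V)

/-- The 2-section graph: two distinct vertices are adjacent if they lie in a common hyperedge. -/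
def MultiHypergraph.twoSection {V : Type*} (H : MultiHypergraph V) : SimpleGraph V where
  Adj u v := u ≠ v ∧ ∃ e ∈ H.edges, u ∈ e ∧ v ∈ e
  symm := ⟨fun _ _ h => ⟨h.1.symm, h.2.imp fun _ he => ⟨he.1, he.2.2, he.2.1⟩⟩⟩
  loopless := ⟨fun _ h => h.1 rfl⟩

/-- `H` is a hypertree: some tree `T` on the vertex set of `H` is such that every hyperedge
induces a connected subgraph of `T`. Empty hyperedges are tolerated. -/
def MultiHypergraph.IsHypertree {V : Type*} (H : MultiHypergraph V) : Prop :=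
  ∃ T : SimpleGraph V, T.IsTree ∧ ∀ e ∈ H.edges, (T.induce (e : Set V)).Preconnected

/-- `D` is an efficient dominating set of the hypergraph `H`. -/
def MultiHypergraph.IsEfficientDominating {V : Type*} (H : MultiHypergraph V) (D : Set V) : Prop :=
  HypertreeED.IsEfficientDominating H.twoSection D

/-! ### Inputs of algorithms and their encoding as words -/

/-- A hypergraph given as input to an algorithm: the number `n` of vertices, which are the
elements of `Fin n`, and a list of the hyperedges. -/
structure Input where
  /-- the number of vertices -/
  n : ℕ
  /-- the list of hyperedges -/
  edgeList : List (Finset (Fin n))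

/-- The hypergraph that an input describes. -/
def Input.toHypergraph (I : Input) : MultiHypergraph (Fin I.n) where
  edges := I.edgeList

/-- The input as a word over the three letters `some true` (1), `some false` (0) and `none` (#):
the number of vertices in unary, followed by `#`, then for each hyperedge its characteristic
vector, that is `n` bits, followed by `#`. -/
def Input.encode (I : Input) : List (Option Bool) :=
  List.replicate I.n (some true) ++ [none] ++
    I.edgeList.flatMap fun e => (List.ofFn fun v : Fin I.n => some (decide (v ∈ e))) ++ [none]

/-- The inputs that describe a hypertree. -/
def HypertreeInput : Type :=
  {I : Input // I.toHypergraph.IsHypertree}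

/-- The word that describes a hypertree. -/
def HypertreeInput.encode (I : HypertreeInput) : List (Option Bool) :=
  I.val.encode

open Classical in
/-- The ED problem on hypertrees: does the given hypertree have an efficient dominating set? -/
noncomputable def efficientDominationProblem (I : HypertreeInput) : Bool :=
  decide (∃ D : Set (Fin I.val.n), I.val.toHypergraph.IsEfficientDominating D)

end HypertreeED

/-! In the 2-section of a hypertree, $N[v]$ consists of $v$ and the hyperedges through $v$, so it is
a subtree of the host tree $T$ (`preconnected_closedNbhd`). Both claims rest on this fact. Root $T$.

Dual chordality: let $top(v)$ be the vertex of $N[v]$ closest to the root, and order the vertices by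
decreasing (depth of $top(v)$, depth of $v$). Suppose $w\in N[v]$, $x\in N[w]$ and $top(x)$ is no
deeper than $top(v)$. The subtree $N[x]$ contains $w$, which lies below $top(v)$, and a vertex no
deeper than $top(v)$; hence it contains $top(v)$. So $top(v)$ is a maximum neighbour of $v$ among
the vertices not yet removed.

Efficient domination: an efficient dominating set is a choice, for each vertex, of a dominator such
that any two chosen dominators are equal or have disjoint closed neighbourhoods. `refine` deletes a
candidate $d$ if some vertex has no candidate dominator compatible with $d$. Members of an efficient
dominating set are never deleted, and $n$ rounds reach a stable set. Conversely, from a nonempty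
stable set dominators can be chosen greedily down the tree, each compatible with that of the parent.
Since the $N[d]$ are subtrees, compatibility along tree edges propagates to all vertices
(`exists_isEfficientDominating_of_refine_eq`). So the answer is yes iff the stable set is nonempty.

Polynomial time: survival in a round is a fixed formula with quantifiers over vertices and over
positions of the input word. Such formulas are evaluated in polynomial time by nested loops over
unary counters (`Fm.runsIn_check`). The loops are written in a small structured language whose runs
are simulated step by step by a multi-stack machine (`Prog.Runs.iterate_step`). -/

namespace HypertreeED

open SimpleGraph

/-! ### Rooted trees -/

/-- The data of a tree with a root: every vertex other than the root has a parent, and the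
edges of the tree are exactly the pairs of a vertex and its parent. -/
structure Rooting {V : Type*} (T : SimpleGraph V) where
  /-- the root -/
  root : V
  /-- the parent of a vertex -/
  par : V → V
  /-- the distance to the root -/
  depth : V → ℕ
  par_root : par root = root
  eq_root : ∀ v, depth v = 0 → v = root
  depth_root : depth root = 0
  depth_par : ∀ v, v ≠ root → depth (par v) + 1 = depth v
  adj : ∀ u v, T.Adj u v → u = par v ∨ v = par u

/-- Every tree can be rooted. -/
theorem Rooting.exists_of_isTree {V : Type*} {T : SimpleGraph V} (hT : T.IsTree) (r : V) :
    ∃ R : Rooting T, R.root = r := by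
  have hc : T.Connected := hT.1
  choose p hp hlen using fun v => hc.exists_path_of_dist v r
  -- The parent is the second vertex of the unique path to the root. If the neighbour `u` is one
  -- step closer, prepending `v` to the path of `u` gives a walk of minimum length, hence that
  -- unique path.
  have key : ∀ u v, T.Adj u v → T.dist u r + 1 = T.dist v r → u = (p v).snd := by
    intro u v h hd
    have hq : (Walk.cons h.symm (p u)).IsPath :=
      Walk.isPath_of_length_eq_dist _ (by rw [Walk.length_cons, hlen, hd])
    have := (hT.existsUnique_path v r).unique (hp v) hq
    rw [this, Walk.snd_cons]
  refine ⟨⟨r, fun v => (p v).snd, fun v => T.dist v r, ?_, ?_, ?_, ?_, ?_⟩, rfl⟩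
  · have : p r = Walk.nil := (hT.existsUnique_path r r).unique (hp r) Walk.IsPath.nil
    rw [this]; rfl
  · intro v hv; exact hc.dist_eq_zero_iff.1 hv
  · simp
  · intro v hv
    have hnn : ¬ (p v).Nil := fun h => hv h.eq
    have h1 : (p v).tail.length + 1 = (p v).length := Walk.length_tail_add_one hnn
    have h2 : T.dist (p v).snd r ≤ (p v).tail.length := dist_le _
    have h3 := hc.dist_triangle (u := v) (v := (p v).snd) (w := r)
    have h4 : T.dist v (p v).snd = 1 := dist_eq_one_iff_adj.2 (Walk.adj_snd hnn)
    have := hlen v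
    omega
  · intro u v h
    have h1 := hT.dist_ne_of_adj r h
    have h3 := hc.dist_triangle (u := u) (v := v) (w := r)
    have h4 : T.dist u v = 1 := dist_eq_one_iff_adj.2 h
    have h5 := hc.dist_triangle (u := v) (v := u) (w := r)
    have h6 : T.dist v u = 1 := dist_eq_one_iff_adj.2 h.symm
    rw [dist_comm (u := r), dist_comm (u := r)] at h1
    rcases lt_or_gt_of_ne h1 with h | h
    · exact .inl (key _ _ ‹_› (by omega))
    · exact .inr (key _ _ (SimpleGraph.Adj.symm ‹_›) (by omega))

/-- A property that passes along the edges inside a connected set and holds somewhere in this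
set holds everywhere in it. -/
theorem forall_mem_of_preconnected {V : Type*} {T : SimpleGraph V} {S : Set V}
    (hS : (T.induce S).Preconnected) {P : V → Prop}
    (hP : ∀ x ∈ S, ∀ y ∈ S, T.Adj x y → P x → P y) {a b : V} (ha : a ∈ S) (hb : b ∈ S)
    (h : P a) : P b := by
  obtain ⟨w⟩ := hS ⟨a, ha⟩ ⟨b, hb⟩
  suffices ∀ (x y : S), (T.induce S).Walk x y → P x → P y from this _ _ w h
  intro x y w
  induction w with
  | nil => exact id
  | cons hadj _ ih => exact fun hx => ih (hP _ (Subtype.prop _) _ (Subtype.prop _) hadj hx)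

namespace Rooting

variable {V : Type*} {T : SimpleGraph V} (R : Rooting T)

/-- `u` lies on the path from `v` to the root. -/
def Anc (u v : V) : Prop := ∃ k, R.par^[k] v = u

theorem depth_par_le (v : V) : R.depth (R.par v) ≤ R.depth v := by
  by_cases h : v = R.root
  · rw [h, R.par_root]
  · have := R.depth_par v h; omega

theorem depth_iterate_le (k : ℕ) (v : V) : R.depth (R.par^[k] v) ≤ R.depth v := by
  induction k generalizing v with
  | zero => rfl
  | succ k ih => exact (ih _).trans (R.depth_par_le v)

/-- Passing to the parent strictly lowers the depth except at the root, where it does nothing. -/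
theorem Anc.eq_of_depth_le {R : Rooting T} {u v : V} (h : R.Anc u v)
    (hd : R.depth v ≤ R.depth u) : u = v := by
  obtain ⟨k, rfl⟩ := h
  cases k with
  | zero => rfl
  | succ k =>
    by_cases hv : v = R.root
    · subst hv
      exact Function.iterate_fixed R.par_root _
    · have h1 := R.depth_par v hv
      have h2 := R.depth_iterate_le k (R.par v)
      rw [Function.iterate_succ_apply] at hd
      omega

/-- An edge that leaves the subtree below `x` joins `x` to its parent. -/
theorem Anc.of_adj {R : Rooting T} {x y z : V} (h : R.Anc x y) (hyz : T.Adj y z) :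
    R.Anc x z ∨ (y = x ∧ z = R.par x) := by
  obtain ⟨k, hk⟩ := h
  rcases R.adj _ _ hyz with h | h
  · exact .inl ⟨k + 1, by rw [Function.iterate_succ_apply, ← h, hk]⟩
  · cases k with
    | zero => exact .inr ⟨hk, by rw [h]; exact congrArg _ hk⟩
    | succ k => exact .inl ⟨k, by rw [h]; exact hk⟩

/-- A connected set that meets the subtree below `u` but does not contain `u` lies below `u`. -/
theorem anc_of_preconnected {S : Set V} (hS : (T.induce S).Preconnected) {u w x : V}
    (hu : u ∉ S) (hw : w ∈ S) (hx : x ∈ S) (h : R.Anc u w) : R.Anc u x :=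
  forall_mem_of_preconnected hS (fun _ hy _ _ hyz h => (h.of_adj hyz).resolve_right
    fun h' => hu (h'.1 ▸ hy)) hw hx h

/-- A vertex of minimum depth in a connected set `S` is reached from every element of `S` by
passing to parents inside `S`. -/
theorem exists_iterate_par_eq_top {S : Set V} (hS : (T.induce S).Preconnected) {t : V}
    (ht : t ∈ S) (hmin : ∀ x ∈ S, R.depth t ≤ R.depth x) {x : V} (hx : x ∈ S) :
    ∃ k, R.par^[k] x = t ∧ ∀ j ≤ k, R.par^[j] x ∈ S := by
  induction hn : R.depth x generalizing x with
  | zero =>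
    have := hmin x hx
    have h1 := R.eq_root x hn
    have h2 := R.eq_root t (by omega)
    exact ⟨0, by simp [h1, h2], by simpa using hx⟩
  | succ n ih =>
    by_cases hxt : x = t
    · exact ⟨0, hxt, by simpa using hx⟩
    have hxr : x ≠ R.root := by
      rintro rfl
      rw [R.depth_root] at hn; omega
    -- If the parent were missing, `S` could not leave the subtree below `x`. Then `t` would lie
    -- below `x` without being deeper, that is, `t = x`.
    have hp : R.par x ∈ S := by
      by_contra hp
      have : R.Anc x t := forall_mem_of_preconnected hS
        (fun y _ z hz hyz h => (h.of_adj hyz).resolve_right fun h' => hp (h'.2 ▸ hz))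
        hx ht ⟨0, rfl⟩
      exact hxt (this.eq_of_depth_le (hmin x hx))
    obtain ⟨k, hk, hj⟩ := ih hp (by have := R.depth_par x hxr; omega)
    refine ⟨k + 1, hk, fun j hjk => ?_⟩
    cases j with
    | zero => exact hx
    | succ j => exact hj j (by omega)

end Rooting

/-! ### Closed neighbourhoods in hypertrees -/

theorem mem_closedNbhd_comm {V : Type*} {G : SimpleGraph V} {u v : V} :
    u ∈ closedNbhd G v ↔ v ∈ closedNbhd G u := by
  simp only [closedNbhd, Set.mem_ofPred_eq, G.adj_comm, eq_comm]

theorem self_mem_closedNbhd {V : Type*} (G : SimpleGraph V) (v : V) : v ∈ closedNbhd G v :=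
  .inl rfl

theorem mem_closedNbhd_twoSection {V : Type*} (H : MultiHypergraph V) (u v : V) :
    u ∈ closedNbhd H.twoSection v ↔ u = v ∨ ∃ e ∈ H.edges, u ∈ e ∧ v ∈ e := by
  constructor
  · rintro (h | ⟨_, e, he, hv, hu⟩)
    · exact .inl h
    · exact .inr ⟨e, he, hu, hv⟩
  · rintro (h | ⟨e, he, hu, hv⟩)
    · exact .inl h
    · by_cases huv : u = v
      · exact .inl huv
      · exact .inr ⟨Ne.symm huv, e, he, hv, hu⟩

/-- In a hypertree the closed neighbourhoods of the 2-section are subtrees of the host tree. -/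
theorem preconnected_closedNbhd {V : Type*} {H : MultiHypergraph V} {T : SimpleGraph V}
    (hT : ∀ e ∈ H.edges, (T.induce (e : Set V)).Preconnected) (v : V) :
    (T.induce (closedNbhd H.twoSection v)).Preconnected := by
  have key : ∀ w : closedNbhd H.twoSection v,
      (T.induce (closedNbhd H.twoSection v)).Reachable w ⟨v, self_mem_closedNbhd _ v⟩ := by
    rintro ⟨w, hw⟩
    rcases (mem_closedNbhd_twoSection H w v).1 hw with rfl | ⟨e, he, hwe, hve⟩
    · rfl
    · have hsub : (e : Set V) ⊆ closedNbhd H.twoSection v := fun x hx =>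
        (mem_closedNbhd_twoSection H x v).2 (.inr ⟨e, he, hx, hve⟩)
      exact (hT e he ⟨w, hwe⟩ ⟨v, hve⟩).map (induceHomOfLE T hsub).toHom
  exact fun a b => (key a).trans (key b).symm

/-- The 2-section of a hypertree is dually chordal. -/
theorem MultiHypergraph.IsHypertree.isDuallyChordal {V : Type*} [Fintype V]
    {H : MultiHypergraph V} (hH : H.IsHypertree) : IsDuallyChordal H.twoSection := by
  classical
  obtain ⟨T, hT, hconn⟩ := hH
  obtain ⟨r⟩ := hT.1.nonempty
  obtain ⟨R, -⟩ := Rooting.exists_of_isTree hT r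
  set N := closedNbhd H.twoSection with hN
  have hpre : ∀ v, (T.induce (N v)).Preconnected := preconnected_closedNbhd hconn
  have htop : ∀ v, ∃ t ∈ N v, ∀ x ∈ N v, R.depth t ≤ R.depth x := fun v =>
    Set.exists_min_image (N v) R.depth (Set.toFinite _) ⟨v, self_mem_closedNbhd _ v⟩
  choose top htop hmin using htop
  -- The second component breaks ties, so that `top v` is not removed before `v`. The order dual
  -- makes the sorting decreasing.
  let key : V → ℕ ×ₗ ℕ := fun v => toLex (R.depth (top v), R.depth v)
  let e : Fin (Fintype.card V) ≃ V := (Fintype.equivFin V).symm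
  let s := Tuple.sort (fun i => OrderDual.toDual (key (e i)))
  have hs : ∀ i j, i ≤ j → key (e (s j)) ≤ key (e (s i)) := fun i j hij =>
    Tuple.monotone_sort (fun i => OrderDual.toDual (key (e i))) hij
  have htk : ∀ v, key (top v) ≤ key v := by
    intro v
    have h1 : R.depth (top (top v)) ≤ R.depth (top v) := hmin _ _ (self_mem_closedNbhd _ _)
    have h2 : R.depth (top v) ≤ R.depth v := hmin _ _ (self_mem_closedNbhd _ _)
    rw [Prod.Lex.toLex_le_toLex]
    rcases h1.lt_or_eq with h1 | h1
    · exact .inl h1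
    · exact .inr ⟨h1, h2⟩
  have hmax : ∀ v x w, R.depth (top x) ≤ R.depth (top v) → w ∈ N v → x ∈ N w →
      x ∈ N (top v) := by
    intro v x w hd hw hx
    have hanc : ∀ y a, a ∈ N y → R.Anc (top y) a := fun y a ha =>
      let ⟨k, hk, _⟩ := R.exists_iterate_par_eq_top (hpre y) (htop y) (hmin y) ha
      ⟨k, hk⟩
    rw [hN, mem_closedNbhd_comm]
    -- If `top v` is above `x`, it lies on the path from `x` up to `top x` inside `N x`, or else
    -- above `top x`, where the depths force equality. If it is not above `x`, then `N x` joins `w`,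
    -- below `top v`, to `x`, not below it, and must pass through `top v`.
    by_cases hux : R.Anc (top v) x
    · obtain ⟨i, hi⟩ := hux
      obtain ⟨k, hk, hkS⟩ := R.exists_iterate_par_eq_top (hpre x) (htop x) (hmin x)
        (self_mem_closedNbhd _ x)
      rcases le_total i k with hik | hki
      · exact hi ▸ hkS i hik
      · have : R.Anc (top v) (top x) := ⟨i - k, by
          rw [← hk, ← Function.iterate_add_apply, Nat.sub_add_cancel hki, hi]⟩
        rw [this.eq_of_depth_le hd]
        exact htop x
    · by_contra hu
      exact hux (R.anc_of_preconnected (hpre x) hu (mem_closedNbhd_comm.1 hx)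
        (self_mem_closedNbhd _ x) (hanc v w hw))
  refine ⟨s.trans e, fun i => ?_⟩
  set v := e (s i) with hv
  have hdep : ∀ x, i ≤ (s.trans e).symm x → key x ≤ key v := by
    intro x hx
    have := hs _ _ hx
    simpa using this
  -- Had `top v` been removed earlier, both keys would agree, so `v` would have the depth of its
  -- ancestor `top v` and coincide with it.
  have htop_mem : i ≤ (s.trans e).symm (top v) := by
    by_contra hlt
    have h1 : key v ≤ key (top v) := by
      have := hs _ _ (not_le.1 hlt).le
      simpa using this
    have h2 := le_antisymm h1 (htk v)
    have h3 : R.depth v = R.depth (top v) := congrArg (fun p => (ofLex p).2) h2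
    have h4 : R.Anc (top v) v := by
      obtain ⟨k, hk, _⟩ := R.exists_iterate_par_eq_top (hpre v) (htop v) (hmin v)
        (self_mem_closedNbhd _ v)
      exact ⟨k, hk⟩
    rw [h4.eq_of_depth_le h3.le] at hlt
    exact hlt (by simp [hv])
  refine ⟨⟨top v, htop_mem⟩, ?_, ?_⟩
  · rcases htop v with h | h
    · exact .inl (Subtype.ext h)
    · exact .inr h
  · rintro ⟨w, hwi⟩ hw ⟨x, hxi⟩ hx
    have hw' : w ∈ N v := hw.imp (congrArg Subtype.val) id
    have hx' : x ∈ N w := hx.imp (congrArg Subtype.val) id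
    have hd : R.depth (top x) ≤ R.depth (top v) := by
      rcases Prod.Lex.toLex_le_toLex.1 (hdep x hxi) with h | h
      · exact h.le
      · exact h.1.le
    exact (hmax v x w hd hw' hx').imp Subtype.ext id

/-! ### Efficient domination by elimination of candidates -/

section Refine

variable {V : Type*} (G : SimpleGraph V)

/-- The candidates in `C` such that, for every vertex `v`, some candidate dominates `v` without
conflicting with them. -/
def refine (C : Set V) : Set V :=
  {d | d ∈ C ∧ ∀ v, ∃ c ∈ C, v ∈ closedNbhd G c ∧
    ∀ z, z ∈ closedNbhd G c → z ∈ closedNbhd G d → c = d}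

theorem refine_subset (C : Set V) : refine G C ⊆ C := fun _ h => h.1

variable {G}

/-- For `d ∈ D`, the dominator of `v` in `D` is the required witness: a vertex dominated by both it
and `d` forces equality by uniqueness. -/
theorem IsEfficientDominating.subset_refine {D C : Set V} (hD : IsEfficientDominating G D)
    (hDC : D ⊆ C) : D ⊆ refine G C := by
  intro d hd
  refine ⟨hDC hd, fun v => ?_⟩
  obtain ⟨c, ⟨hc, hvc⟩, _⟩ := hD v
  exact ⟨c, hDC hc, hvc, fun z hzc hzd => (hD z).unique ⟨hc, hzc⟩ ⟨hd, hzd⟩⟩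

theorem IsEfficientDominating.subset_iterate_refine {D : Set V} (hD : IsEfficientDominating G D)
    (k : ℕ) : D ⊆ (refine G)^[k] Set.univ := by
  induction k with
  | zero => exact Set.subset_univ _
  | succ k ih =>
    rw [Function.iterate_succ_apply']
    exact hD.subset_refine ih

/-- After as many rounds as there are vertices the set of candidates is stable. -/
theorem refine_iterate_card [Fintype V] :
    refine G ((refine G)^[Fintype.card V] Set.univ) = (refine G)^[Fintype.card V] Set.univ := by
  -- Every round that is not stable loses a candidate. In the second alternative no candidate is
  -- left after `card V` rounds, and the empty set is stable.
  have key : ∀ k, refine G ((refine G)^[k] Set.univ) = (refine G)^[k] Set.univ ∨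
      ((refine G)^[k] Set.univ).ncard + k ≤ Fintype.card V := by
    intro k
    induction k with
    | zero => right; simp [Set.ncard_univ]
    | succ k ih =>
      rw [Function.iterate_succ_apply']
      rcases ih with h | h
      · left; rw [h, h]
      · by_cases h' : refine G ((refine G)^[k] Set.univ) = (refine G)^[k] Set.univ
        · left; rw [h', h']
        · right
          have := Set.ncard_lt_ncard ((refine_subset G _).ssubset_of_ne h') (Set.toFinite _)
          omega
  rcases key (Fintype.card V) with h | h
  · exact h
  · have : ((refine G)^[Fintype.card V] Set.univ) = ∅ := by
      rw [← Set.ncard_eq_zero (Set.toFinite _)]; omega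
    rw [this]
    exact Set.subset_empty_iff.1 (refine_subset G ∅)

/-- If the closed neighbourhoods are subtrees of a tree, then every nonempty stable set of
candidates contains an efficient dominating set. -/
theorem exists_isEfficientDominating_of_refine_eq {T : SimpleGraph V} (hT : T.IsTree)
    (hconn : ∀ v, (T.induce (closedNbhd G v)).Preconnected) {C : Set V}
    (hC : refine G C = C) (hne : C.Nonempty) : ∃ D, IsEfficientDominating G D := by
  obtain ⟨d₀, hd₀⟩ := hne
  -- Rooting at a candidate makes `d₀` a valid dominator of the root.
  obtain ⟨R, hR⟩ := Rooting.exists_of_isTree hT d₀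
  have step : ∀ v d, ∃ c, d ∈ C → c ∈ C ∧ v ∈ closedNbhd G c ∧
      ∀ z, z ∈ closedNbhd G c → z ∈ closedNbhd G d → c = d := by
    intro v d
    by_cases hd : d ∈ C
    · obtain ⟨c, hc⟩ := (hC.symm.subset hd).2 v
      exact ⟨c, fun _ => hc⟩
    · exact ⟨d, fun h => absurd h hd⟩
  choose f hf using step
  -- The greedy choice, by recursion on depth: the root receives `d₀`, and any other vertex receives
  -- a dominator compatible with that of its parent.
  let y : ℕ → V → V := Nat.rec (fun _ => d₀) (fun _ g v => f v (g (R.par v)))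
  let x : V → V := fun v => y (R.depth v) v
  have hroot : ∀ v, R.depth v = 0 → x v = d₀ := fun v hv => by
    change y (R.depth v) v = d₀
    rw [hv]
    rfl
  have hpar : ∀ v k, R.depth v = k + 1 → R.depth (R.par v) = k ∧ x v = f v (x (R.par v)) := by
    intro v k hk
    have h1 : R.depth (R.par v) = k := by
      have := R.depth_par v (by rintro rfl; rw [R.depth_root] at hk; omega)
      omega
    exact ⟨h1, by simp only [x, hk, h1, y]⟩
  have hx : ∀ k v, R.depth v = k → x v ∈ C ∧ v ∈ closedNbhd G (x v) := by
    intro k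
    induction k with
    | zero =>
      intro v hv
      rw [hroot v hv, R.eq_root v hv, hR]
      exact ⟨hd₀, self_mem_closedNbhd G d₀⟩
    | succ k ih =>
      intro v hv
      obtain ⟨h1, h2⟩ := hpar v k hv
      have := hf v _ (ih _ h1).1
      rw [h2]
      exact ⟨this.1, this.2.1⟩
  have hedge : ∀ v z, z ∈ closedNbhd G (x v) → z ∈ closedNbhd G (x (R.par v)) →
      x v = x (R.par v) := by
    intro v z h1 h2
    rcases hv : R.depth v with _ | k
    · rw [R.eq_root v hv, R.par_root]
    · obtain ⟨h3, h4⟩ := hpar v k hv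
      rw [h4] at h1 ⊢
      exact (hf v _ (hx _ _ h3).1).2.2 z h1 h2
  -- The choice is constant on the subtree `closedNbhd G (x v)`. Across a tree edge inside it, the
  -- new endpoint `b` is dominated both by `x b` and by `x v`, so `hedge` identifies the two.
  have hclass : ∀ v u, u ∈ closedNbhd G (x v) → x u = x v := by
    intro v u hu
    refine forall_mem_of_preconnected (hconn (x v)) (P := fun w => x w = x v) ?_
      (hx _ v rfl).2 hu rfl
    intro a ha b hb hab hav
    rcases R.adj a b hab with h | h
    · rw [← hav, h]
      refine hedge b b (hx _ b rfl).2 ?_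
      rwa [← h, hav]
    · rw [h, ← hav, eq_comm, hedge a b]
      · rwa [hav]
      · rw [← h]; exact (hx _ b rfl).2
  refine ⟨Set.range x, fun v => ⟨x v, ⟨⟨v, rfl⟩, (hx _ v rfl).2⟩, ?_⟩⟩
  rintro _ ⟨⟨w, rfl⟩, hv⟩
  exact (hclass w v hv).symm

/-- The elimination of candidates decides whether a hypertree has an efficient dominating set. -/
theorem MultiHypergraph.IsHypertree.exists_isEfficientDominating_iff [Fintype V]
    {H : MultiHypergraph V} (hH : H.IsHypertree) :
    (∃ D, H.IsEfficientDominating D) ↔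
      ((refine H.twoSection)^[Fintype.card V] Set.univ).Nonempty := by
  obtain ⟨T, hT, hconn⟩ := hH
  constructor
  · rintro ⟨D, hD⟩
    obtain ⟨v⟩ := hT.1.nonempty
    obtain ⟨d, ⟨hd, _⟩, _⟩ := hD v
    exact ⟨d, IsEfficientDominating.subset_iterate_refine hD _ hd⟩
  · exact exists_isEfficientDominating_of_refine_eq hT (preconnected_closedNbhd hconn)
      refine_iterate_card

end Refine

open Turing

/-! ### Structured programs for multi-stack machines -/

/-- The memory of a program: a flag, a stack of saved flags, and stacks of letters. -/
@[ext]
structure Memory (K A : Type) where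
  /-- the flag -/
  flag : Bool
  /-- the saved flags -/
  acc : List Bool
  /-- the stacks -/
  stk : K → List A

/-- The elementary operations. -/
inductive Op (K A : Type)
  /-- move the top of the first stack to the second stack -/
  | move (k k' : K)
  /-- remove the top of a stack -/
  | drop (k : K)
  /-- push a letter that may depend on the flag -/
  | push (k : K) (f : Bool → A)
  /-- clear the flag unless the given letter is on top of the stack -/
  | test (k : K) (a : A)
  /-- change the flag -/
  | flag (f : Bool → Bool)
  /-- save the flag -/
  | save
  /-- combine the flag that was saved last with the present one -/
  | combine (f : Bool → Bool → Bool)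

/-- Structured programs. -/
inductive Prog (K A : Type)
  | op (a : Op K A)
  | seq (p q : Prog K A)
  /-- branch on the flag -/
  | ite (p q : Prog K A)
  /-- repeat as long as a stack is nonempty -/
  | loop (k : K) (p : Prog K A)

namespace Prog

variable {K A : Type}

/-- The labels of the machine that runs a program. -/
def Label : Prog K A → Type
  | op _ => Unit
  | seq p q => p.Label ⊕ q.Label
  | ite p q => Option (p.Label ⊕ q.Label)
  | loop _ p => Option p.Label

/-- A program has finitely many labels. -/
instance Label.instFinite : (p : Prog K A) → Finite p.Label
  | op _ => inferInstanceAs (Finite Unit)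
  | seq p q =>
    have := instFinite p
    have := instFinite q
    inferInstanceAs (Finite (p.Label ⊕ q.Label))
  | ite p q =>
    have := instFinite p
    have := instFinite q
    inferInstanceAs (Finite (Option (p.Label ⊕ q.Label)))
  | loop _ p =>
    have := instFinite p
    inferInstanceAs (Finite (Option p.Label))

/-- The first label of a program. -/
def start : (p : Prog K A) → p.Label
  | op _ => ()
  | seq p _ => Sum.inl p.start
  | ite _ _ => none
  | loop _ _ => none

end Prog

/-- The alphabets of the stacks: the additional stack holds the saved flags. -/
abbrev StackAlphabet (K A : Type) : Option K → Type
  | none => Bool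
  | some _ => A

/-- The internal states: the flag and a letter in transit. -/
abbrev Register (A : Type) : Type := Bool × Option A

section Memory

variable {K A : Type}

/-- The contents of the stacks of the machine. -/
def Memory.stacks (s : Memory K A) : ∀ k, List (StackAlphabet K A k)
  | none => s.acc
  | some k => s.stk k

/-- The configuration of the machine at a label. -/
def Memory.cfg {Λ : Type} (l : Option Λ) (s : Memory K A) :
    TM2.Cfg (StackAlphabet K A) Λ (Register A) :=
  ⟨l, (s.flag, none), s.stacks⟩

variable [DecidableEq K]

theorem Memory.update_stacks_some (s : Memory K A) (k : K) (l : List A) :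
    Function.update s.stacks (some k) l =
      Memory.stacks { s with stk := Function.update s.stk k l } := by
  funext j
  cases j with
  | none => simp [Memory.stacks]
  | some j =>
    by_cases h : j = k
    · subst h; simp [Memory.stacks]
    · simp [Memory.stacks, h]

theorem Memory.update_stacks_none (s : Memory K A) (l : List Bool) :
    Function.update s.stacks none l = Memory.stacks { s with acc := l } := by
  funext j
  cases j <;> simp [Memory.stacks]

end Memory

section Run

variable {K A : Type} [DecidableEq K] [DecidableEq A]

/-- The effect of an elementary operation. -/
def Op.run : Op K A → Memory K A → Memory K A
  | move k k', s => match s.stk k with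
    | [] => s
    | a :: l => { s with
        stk := Function.update (Function.update s.stk k l) k'
          (a :: Function.update s.stk k l k') }
  | drop k, s => { s with stk := Function.update s.stk k (s.stk k).tail }
  | push k f, s => { s with stk := Function.update s.stk k (f s.flag :: s.stk k) }
  | test k a, s => { s with flag := s.flag && decide ((s.stk k).head? = some a) }
  | flag f, s => { s with flag := f s.flag }
  | save, s => { s with acc := s.flag :: s.acc }
  | combine f, s => { s with flag := f (s.acc.head?.getD false) s.flag, acc := s.acc.tail }

/-- The machine code of an elementary operation. -/
def Op.code {Λ : Type} [Inhabited A] (q : TM2.Stmt (StackAlphabet K A) Λ (Register A)) :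
    Op K A → TM2.Stmt (StackAlphabet K A) Λ (Register A)
  | move k k' => .pop (some k) (fun v x => (v.1, x)) <|
      .branch (fun v => v.2.isSome)
        -- The default is never pushed, since the branch requires a letter in transit. Afterwards
        -- the register is emptied, as `Memory.cfg` expects between operations.
        (.push (some k') (fun v => v.2.getD default) (.load (fun v => (v.1, none)) q)) q
  | drop k => .pop (some k) (fun v _ => v) q
  | push k f => .push (some k) (fun v => f v.1) q
  | test k a => .peek (some k) (fun v x => (v.1 && decide (x = some a), v.2)) q
  | flag f => .load (fun v => (f v.1, v.2)) q
  | save => .push none (fun v => v.1) q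
  | combine f => .pop none (fun v x => (f (x.getD false) v.1, v.2)) q

/-- `p.Runs t s s'`: started with the memory `s` the program `p` stops after `t` steps with the
memory `s'`. -/
inductive Prog.Runs : Prog K A → ℕ → Memory K A → Memory K A → Prop
  | op (a : Op K A) (s) : Runs (.op a) 1 s (a.run s)
  | seq {p q t t' s s' s''} : Runs p t s s' → Runs q t' s' s'' → Runs (.seq p q) (t + t') s s''
  | ite_true {p q t s s'} : s.flag = true → Runs p t s s' → Runs (.ite p q) (t + 1) s s'
  | ite_false {p q t s s'} : s.flag = false → Runs q t s s' → Runs (.ite p q) (t + 1) s s'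
  | loop_nil {k p s} : s.stk k = [] → Runs (.loop k p) 1 s s
  | loop_cons {k p t t' s s' s''} : s.stk k ≠ [] → Runs p t s s' → Runs (.loop k p) t' s' s'' →
      Runs (.loop k p) (t + t' + 1) s s''

/-- The machine code of a program that is embedded in a larger one by `emb`, and after which the
machine continues at the label `exit`. -/
def Prog.code [Inhabited A] {Λ : Type} : (p : Prog K A) → (emb : p.Label → Λ) → (exit : Λ) →
    p.Label → TM2.Stmt (StackAlphabet K A) Λ (Register A)
  | op a, _, exit, _ => a.code (.goto fun _ => exit)
  | seq p q, emb, _, Sum.inl l => p.code (fun l => emb (Sum.inl l)) (emb (Sum.inr q.start)) l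
  | seq _ q, emb, exit, Sum.inr l => q.code (fun l => emb (Sum.inr l)) exit l
  | ite p q, emb, _, none => .branch (fun v => v.1) (.goto fun _ => emb (some (Sum.inl p.start)))
      (.goto fun _ => emb (some (Sum.inr q.start)))
  | ite p _, emb, exit, some (Sum.inl l) => p.code (fun l => emb (some (Sum.inl l))) exit l
  | ite _ q, emb, exit, some (Sum.inr l) => q.code (fun l => emb (some (Sum.inr l))) exit l
  | loop k p, emb, exit, none => .peek (some k) (fun v x => (v.1, x)) <|
      .branch (fun v => v.2.isSome)
        (.load (fun v => (v.1, none)) (.goto fun _ => emb (some p.start)))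
        (.load (fun v => (v.1, none)) (.goto fun _ => exit))
  | loop _ p, emb, _, some l => p.code (fun l => emb (some l)) (emb none) l

/-- Every elementary operation compiles to one statement ending in a jump, hence costs exactly one
machine step. -/
theorem Op.stepAux_code {Λ : Type} [Inhabited A] (a : Op K A) (l : Λ) (s : Memory K A) :
    TM2.stepAux (a.code (.goto fun _ => l)) (s.flag, none) s.stacks =
      Memory.cfg (some l) (a.run s) := by
  cases a with
  | move k k' =>
    rcases h : s.stk k with _ | ⟨a, m⟩
    · have h1 : s.stacks (some k) = [] := h
      simp only [Op.code, TM2.stepAux, Op.run, h, h1, Memory.cfg, List.head?_nil,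
        Option.isSome_none, cond_false, List.tail_nil, Memory.update_stacks_some]
      congr 2
      rw [← h, Function.update_eq_self]
    · have h1 : s.stacks (some k) = a :: m := h
      simp only [Op.code, TM2.stepAux, Op.run, h, h1, Memory.cfg, List.head?_cons,
        Option.isSome_some, cond_true, List.tail_cons, Memory.update_stacks_some]
      rfl
  | drop k =>
    simp only [Op.code, TM2.stepAux, Op.run, Memory.cfg, Memory.update_stacks_some]
    rfl
  | push k f =>
    simp only [Op.code, TM2.stepAux, Op.run, Memory.cfg, Memory.update_stacks_some]
    rfl
  | test k a => rfl
  | flag f => rfl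
  | save =>
    simp only [Op.code, TM2.stepAux, Op.run, Memory.cfg, Memory.update_stacks_none]
    rfl
  | combine f =>
    simp only [Op.code, TM2.stepAux, Op.run, Memory.cfg, Memory.update_stacks_none]
    rfl

/-- A machine that contains the code of a program runs it. -/
theorem Prog.Runs.iterate_step [Inhabited A] {Λ : Type}
    {M : Λ → TM2.Stmt (StackAlphabet K A) Λ (Register A)} {p : Prog K A} {t : ℕ}
    {s s' : Memory K A} (h : p.Runs t s s') :
    ∀ {emb : p.Label → Λ} {exit : Λ}, (∀ l, M (emb l) = p.code emb exit l) →
      (flip bind (TM2.step M))^[t] (some (s.cfg (some (emb p.start)))) =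
        some (s'.cfg (some exit)) := by
  -- The embedding and the exit stay general: a subprogram is embedded through its parent, and it
  -- exits to the start of its successor or, for a loop body, to the loop test.
  induction h with
  | op a s =>
    intro emb exit hM
    exact congrArg some ((congrArg (fun q => TM2.stepAux q _ _) (hM ())).trans
      (a.stepAux_code exit s))
  | @seq p q t t' s s' s'' _ _ ih ih' =>
    intro emb exit hM
    have h1 := ih (emb := fun l => emb (Sum.inl l)) (exit := emb (Sum.inr q.start))
      fun l => hM (Sum.inl l)
    have h2 := ih' (emb := fun l => emb (Sum.inr l)) (exit := exit) fun l => hM (Sum.inr l)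
    rw [add_comm, Function.iterate_add_apply]
    exact (congrArg _ h1).trans h2
  | @ite_true p q t s s' hs _ ih =>
    intro emb exit hM
    have h1 := ih (emb := fun l => emb (some (Sum.inl l))) (exit := exit)
      fun l => hM (some (Sum.inl l))
    rw [Function.iterate_succ_apply]
    refine Eq.trans (congrArg _ (congrArg some ?_)) h1
    refine (congrArg (fun q => TM2.stepAux q _ _) (hM none)).trans ?_
    simp [Prog.code, hs, Memory.cfg]
  | @ite_false p q t s s' hs _ ih =>
    intro emb exit hM
    have h1 := ih (emb := fun l => emb (some (Sum.inr l))) (exit := exit)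
      fun l => hM (some (Sum.inr l))
    rw [Function.iterate_succ_apply]
    refine Eq.trans (congrArg _ (congrArg some ?_)) h1
    refine (congrArg (fun q => TM2.stepAux q _ _) (hM none)).trans ?_
    simp [Prog.code, hs, Memory.cfg]
  | @loop_nil k p s hs =>
    intro emb exit hM
    refine congrArg some ((congrArg (fun q => TM2.stepAux q _ _) (hM none)).trans ?_)
    have h1 : s.stacks (some k) = [] := hs
    simp [Prog.code, h1, Memory.cfg]
  | @loop_cons k p t t' s s' s'' hs _ _ ih ih' =>
    intro emb exit hM
    have h1 := ih (emb := fun l => emb (some l)) (exit := emb none) fun l => hM (some l)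
    have h2 := ih' hM
    rw [Function.iterate_succ_apply, add_comm, Function.iterate_add_apply]
    refine Eq.trans (congrArg _ ((congrArg _ (congrArg some ?_)).trans h1)) h2
    refine (congrArg (fun q => TM2.stepAux q _ _) (hM none)).trans ?_
    obtain ⟨a, m, hs⟩ := List.exists_cons_of_ne_nil hs
    have h1 : s.stacks (some k) = a :: m := hs
    simp [Prog.code, h1, Memory.cfg]

end Run

/-! ### Time bounds for programs -/

namespace Prog

variable {K A : Type} [DecidableEq K] [DecidableEq A]

/-- Started with the memory `s` the program `p` stops after at most `t` steps with the
memory `s'`. -/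
def RunsIn (p : Prog K A) (t : ℕ) (s s' : Memory K A) : Prop :=
  ∃ t' ≤ t, p.Runs t' s s'

namespace RunsIn

variable {p q : Prog K A} {t t' : ℕ} {s s' s'' : Memory K A}

theorem mono (h : p.RunsIn t s s') (ht : t ≤ t') : p.RunsIn t' s s' :=
  let ⟨u, hu, h⟩ := h
  ⟨u, hu.trans ht, h⟩

theorem congr (h : p.RunsIn t s s') (hs : s' = s'') : p.RunsIn t s s'' := hs ▸ h

theorem op {a : Op K A} (h : a.run s = s') : (Prog.op a).RunsIn 1 s s' :=
  ⟨1, le_rfl, h ▸ Runs.op a s⟩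

theorem seq (h : p.RunsIn t s s') (h' : q.RunsIn t' s' s'') :
    (Prog.seq p q).RunsIn (t + t') s s'' :=
  let ⟨u, hu, h⟩ := h
  let ⟨u', hu', h'⟩ := h'
  ⟨u + u', add_le_add hu hu', h.seq h'⟩

theorem ite_true (hs : s.flag = true) (h : p.RunsIn t s s') :
    (Prog.ite p q).RunsIn (t + 1) s s' :=
  let ⟨u, hu, h⟩ := h
  ⟨u + 1, add_le_add_left hu 1, .ite_true hs h⟩

theorem ite_false (hs : s.flag = false) (h : q.RunsIn t s s') :
    (Prog.ite p q).RunsIn (t + 1) s s' :=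
  let ⟨u, hu, h⟩ := h
  ⟨u + 1, add_le_add_left hu 1, .ite_false hs h⟩

theorem loop_nil {k : K} (hs : s.stk k = []) : (Prog.loop k p).RunsIn 1 s s :=
  ⟨1, le_rfl, .loop_nil hs⟩

theorem loop_cons {k : K} (hs : s.stk k ≠ []) (h : p.RunsIn t s s')
    (h' : (Prog.loop k p).RunsIn t' s' s'') : (Prog.loop k p).RunsIn (t + t' + 1) s s'' :=
  let ⟨u, hu, h⟩ := h
  let ⟨u', hu', h'⟩ := h'
  ⟨u + u' + 1, by omega, .loop_cons hs h h'⟩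

/-- A loop whose body runs `n` times. -/
theorem loop {k : K} (n : ℕ) (f : ℕ → Memory K A)
    (h : ∀ i < n, (f i).stk k ≠ [] ∧ p.RunsIn t (f i) (f (i + 1))) (hn : (f n).stk k = []) :
    (Prog.loop k p).RunsIn (n * (t + 1) + 1) (f 0) (f n) := by
  induction n generalizing f with
  | zero => simpa using loop_nil hn
  | succ n ih =>
    have h0 := h 0 n.succ_pos
    refine (loop_cons h0.1 h0.2 (ih (fun i => f (i + 1)) (fun i hi => h (i + 1) (by omega))
      hn)).mono (le_of_eq (by ring))

end RunsIn

end Prog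

section Move

variable {K A : Type} [DecidableEq K] [DecidableEq A]

theorem Op.run_move_nil {s : Memory K A} {k : K} (k' : K) (h : s.stk k = []) :
    (Op.move k k').run s = s := by
  simp [Op.run, h]

theorem Op.run_move_cons {s : Memory K A} {k k' : K} {a : A} {l : List A} (hk : k ≠ k')
    (h : s.stk k = a :: l) : (Op.move k k').run s =
      { s with stk := Function.update (Function.update s.stk k l) k' (a :: s.stk k') } := by
  simp [Op.run, h, Function.update_of_ne hk.symm]

/-- Moving a whole stack onto another one. -/
theorem runsIn_transfer {k k' : K} (hk : k ≠ k') (s : Memory K A) :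
    (Prog.loop k (.op (.move k k'))).RunsIn (2 * (s.stk k).length + 1) s
      { s with
        stk := Function.update (Function.update s.stk k []) k'
          ((s.stk k).reverse ++ s.stk k') } := by
  induction h : s.stk k generalizing s with
  | nil =>
    have : Function.update (Function.update s.stk k []) k' ([].reverse ++ s.stk k') = s.stk := by
      rw [← h, Function.update_eq_self]
      simp [h]
    rw [this]
    exact .loop_nil h
  | cons a l ih =>
    have h1 := Op.run_move_cons hk h
    have h2 := ih ((Op.move k k').run s) (by rw [h1]; simp [Function.update_of_ne hk])
    refine ((Prog.RunsIn.loop_cons (by rw [h]; simp) (.op rfl) h2).mono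
      (by simp; omega)).congr ?_
    rw [h1]
    ext : 1 <;> try rfl
    funext j
    by_cases h' : j = k'
    · subst h'; simp
    · by_cases hj : j = k <;> simp [Function.update_apply, h', hj]

end Move

/-! ### Formulas with bounded quantifiers -/

/-- The letters of the input words. -/
abbrev Letter : Type := Option Bool

/-- The names of the stacks: two words that are read through a second stack each, for every
variable a counter with its value and one with the difference to its bound, a stack for
intermediate results and one for a word under construction. -/
inductive Stack (X : Type)
  | word (w : Bool)
  | read (w : Bool)
  | ctr (x : X) (b : Bool)
  | tmp
  | new
  deriving DecidableEq

/-- The values that are stored on the stacks: two words, the values of the variables and their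
bounds, and a word under construction. -/
structure Env (X : Type) where
  /-- the words -/
  word : Bool → List Letter
  /-- the values of the variables -/
  val : X → ℕ
  /-- the bounds of the variables -/
  bnd : X → ℕ
  /-- the word under construction -/
  new : List Letter

/-- Formulas about two words whose quantifiers range over the numbers from 1 to the bound of
the variable. -/
inductive Fm (X : Type)
  /-- the letter at a position; the position is a sum of values of variables and of
  differences of variables to their bounds -/
  | look (w : Bool) (addr : List (X × Bool)) (a : Letter)
  | neg (φ : Fm X)
  | and (φ ψ : Fm X)
  | ex (x : X) (φ : Fm X)

section Fm

variable {X : Type}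

namespace Env

/-- The height of a counter. -/
def count (E : Env X) (k : X × Bool) : ℕ :=
  if k.2 then E.bnd k.1 - E.val k.1 else E.val k.1

/-- The contents of the stacks. -/
def stk (E : Env X) : Stack X → List Letter
  | .word w => E.word w
  | .read _ => []
  | .ctr x b => List.replicate (E.count (x, b)) none
  | .tmp => []
  | .new => E.new

/-- The memory of a program that stores the environment. -/
def mem (E : Env X) (fl : Bool) (acc : List Bool) : Memory (Stack X) Letter :=
  ⟨fl, acc, E.stk⟩

variable [DecidableEq X]

/-- Change the value of a variable. -/
def set (E : Env X) (x : X) (i : ℕ) : Env X :=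
  { E with val := Function.update E.val x i }

/-- All words and numbers in the environment are bounded. -/
def Fits (E : Env X) (B : ℕ) : Prop :=
  (∀ w, (E.word w).length ≤ B) ∧ ∀ x, E.val x ≤ E.bnd x ∧ E.bnd x ≤ B

omit [DecidableEq X] in
theorem Fits.count_le {E : Env X} {B : ℕ} (h : E.Fits B) (k : X × Bool) : E.count k ≤ B := by
  have := h.2 k.1
  unfold count
  split <;> omega

theorem Fits.set {E : Env X} {B : ℕ} (h : E.Fits B) {x : X} {i : ℕ} (hi : i ≤ E.bnd x) :
    (E.set x i).Fits B := by
  refine ⟨h.1, fun y => ⟨?_, (h.2 y).2⟩⟩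
  by_cases hy : y = x
  · subst hy; simpa [Env.set] using hi
  · simpa [Env.set, hy] using (h.2 y).1

theorem set_eq_self {E : Env X} {x : X} {i : ℕ} (h : E.val x = i) : E.set x i = E := by
  subst h; simp [Env.set]

theorem runsIn_flag (E : Env X) (f : Bool → Bool) (fl : Bool) (acc : List Bool) :
    (Prog.op (.flag f)).RunsIn 1 (E.mem fl acc) (E.mem (f fl) acc) := .op rfl

theorem runsIn_save (E : Env X) (fl : Bool) (acc : List Bool) :
    (Prog.op .save).RunsIn 1 (E.mem fl acc) (E.mem fl (fl :: acc)) := .op rfl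

theorem runsIn_combine (E : Env X) (f : Bool → Bool → Bool) (fl b : Bool) (acc : List Bool) :
    (Prog.op (.combine f)).RunsIn 1 (E.mem fl (b :: acc)) (E.mem (f b fl) acc) := .op rfl

/-- Increasing a variable on the stacks. -/
theorem run_move_succ (E : Env X) (x : X) {i : ℕ} (hi : i < E.bnd x) (fl : Bool)
    (acc : List Bool) : (Op.move (.ctr x true) (.ctr x false)).run ((E.set x i).mem fl acc) =
      (E.set x (i + 1)).mem fl acc := by
  obtain ⟨m, hm⟩ : ∃ m, E.bnd x - i = m + 1 := ⟨E.bnd x - i - 1, by omega⟩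
  have hm' : E.bnd x - (i + 1) = m := by omega
  rw [Op.run_move_cons (by simp) (a := none) (l := List.replicate m none)
    (by simp [mem, stk, count, Env.set, hm, List.replicate_succ])]
  ext : 1 <;> try rfl
  funext j
  rcases j with w | w | ⟨y, b⟩ | _ | _ <;> try rfl
  by_cases hy : y = x
  · subst hy
    cases b <;> simp [mem, stk, count, Env.set, hm', List.replicate_succ]
  · simp [mem, stk, count, Env.set, hy]

/-- Setting a variable to zero on the stacks. -/
theorem runsIn_reset (E : Env X) (x : X) {i : ℕ} (hi : i ≤ E.bnd x) (fl : Bool)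
    (acc : List Bool) :
    (Prog.loop (.ctr x false) (.op (.move (.ctr x false) (.ctr x true)))).RunsIn (2 * i + 1)
      ((E.set x i).mem fl acc) ((E.set x 0).mem fl acc) := by
  have h := runsIn_transfer (k := .ctr x false) (k' := .ctr x true) (by simp)
    ((E.set x i).mem fl acc)
  refine (h.mono (by simp [mem, stk, count, Env.set])).congr ?_
  ext : 1 <;> try rfl
  funext j
  rcases j with w | w | ⟨y, b⟩ | _ | _ <;> try rfl
  by_cases hy : y = x
  · subst hy
    cases b <;> simp [mem, stk, count, Env.set, hi]
  · simp [mem, stk, count, Env.set, hy]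

/-- The stacks while a word is read: `p` letters have been read, and `j` of the letters of the
counter `k` are on the intermediate stack, `i` are left. -/
def reading (E : Env X) (fl : Bool) (acc : List Bool) (w : Bool) (p : ℕ) (k : X × Bool)
    (i j : ℕ) : Memory (Stack X) Letter where
  flag := fl
  acc := acc
  stk
    | .word w' => if w' = w then (E.word w).drop p else E.word w'
    | .read w' => if w' = w then ((E.word w).take p).reverse else []
    | .ctr x b => List.replicate (if (x, b) = k then i else E.count (x, b)) none
    | .tmp => List.replicate j none
    | .new => E.new

theorem reading_zero (E : Env X) (fl : Bool) (acc : List Bool) (w : Bool) (k : X × Bool) :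
    E.reading fl acc w 0 k (E.count k) 0 = E.mem fl acc := by
  ext : 1 <;> try rfl
  funext j
  rcases j with w' | w' | ⟨y, b⟩ | _ | _ <;> simp [reading, mem, stk]
  · rintro rfl; rfl
  · rintro rfl; rfl

/-- Between two summands of an address the borrowed counter is intact, so the next summand may use
another counter. -/
theorem reading_congr (E : Env X) (fl : Bool) (acc : List Bool) (w : Bool) (p : ℕ)
    (k k' : X × Bool) :
    E.reading fl acc w p k (E.count k) 0 = E.reading fl acc w p k' (E.count k') 0 := by
  ext : 1 <;> try rfl
  funext j
  rcases j with w' | w' | ⟨y, b⟩ | _ | _ <;> simp only [reading]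
  have : ∀ k, (if (y, b) = k then E.count k else E.count (y, b)) = E.count (y, b) := by
    intro k
    split_ifs with h
    · rw [h]
    · rfl
  rw [this, this]

/-- Read as many letters of a word as the height of a counter says. -/
def advance (w : Bool) (k : X × Bool) : Prog (Stack X) Letter :=
  .seq (.loop (.ctr k.1 k.2)
      (.seq (.op (.move (.ctr k.1 k.2) .tmp)) (.op (.move (.word w) (.read w)))))
    (.loop .tmp (.op (.move .tmp (.ctr k.1 k.2))))

/-- Past the end of the word the move does nothing, and neither do `take` and `drop` change. Hence
addresses beyond the word need no separate treatment. -/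
theorem run_move_read (E : Env X) (fl : Bool) (acc : List Bool) (w : Bool) (p : ℕ) (k : X × Bool)
    (i j : ℕ) : (Op.move (.word w) (.read w)).run (E.reading fl acc w p k i j) =
      E.reading fl acc w (p + 1) k i j := by
  rcases h : (E.word w).drop p with _ | ⟨a, l⟩
  · rw [Op.run_move_nil _ (by simp [reading, h])]
    have hp : (E.word w).length ≤ p := by simpa using h
    simp [reading, List.drop_eq_nil_of_le, List.take_of_length_le, hp, hp.trans p.le_succ]
  · rw [Op.run_move_cons (by simp) (a := a) (l := l) (by simp [reading, h])]
    have h1 : (E.word w).drop (p + 1) = l := by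
      rw [← List.drop_drop, h]; rfl
    have h2 : (E.word w).take (p + 1) = (E.word w).take p ++ [a] := by
      rw [List.take_add, h]; rfl
    ext : 1 <;> try rfl
    funext j
    rcases j with w' | w' | ⟨y, b⟩ | _ | _ <;> try rfl
    · by_cases hw : w' = w <;> simp [reading, hw, h1]
    · by_cases hw : w' = w <;> simp [Function.update_apply, reading, hw, h2]

theorem run_move_tmp (E : Env X) (fl : Bool) (acc : List Bool) (w : Bool) (p : ℕ) (k : X × Bool)
    (i j : ℕ) : (Op.move (.ctr k.1 k.2) .tmp).run (E.reading fl acc w p k (i + 1) j) =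
      E.reading fl acc w p k i (j + 1) := by
  rw [Op.run_move_cons (by simp) (a := none) (l := List.replicate i none)
    (by simp [reading, List.replicate_succ])]
  ext : 1 <;> try rfl
  funext l
  rcases l with w' | w' | ⟨y, b⟩ | _ | _ <;> try rfl
  by_cases hk : (y, b) = k
  · subst hk; simp [reading]
  · have : ¬ (y = k.1 ∧ b = k.2) := fun h => hk (Prod.ext h.1 h.2)
    simp [reading, hk, this]

theorem run_move_ctr (E : Env X) (fl : Bool) (acc : List Bool) (w : Bool) (p : ℕ) (k : X × Bool)
    (i j : ℕ) : (Op.move .tmp (.ctr k.1 k.2)).run (E.reading fl acc w p k i (j + 1)) =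
      E.reading fl acc w p k (i + 1) j := by
  rw [Op.run_move_cons (by simp) (a := none) (l := List.replicate j none)
    (by simp [reading, List.replicate_succ])]
  ext : 1 <;> try rfl
  funext l
  rcases l with w' | w' | ⟨y, b⟩ | _ | _ <;> try rfl
  by_cases hk : (y, b) = k
  · subst hk; simp [reading, List.replicate_succ]
  · have : ¬ (y = k.1 ∧ b = k.2) := fun h => hk (Prod.ext h.1 h.2)
    simp [reading, hk, this]

/-- Each unit of the counter costs three steps in the reading loop (two moves and the loop test) and
two in the loop that restores the counter; leaving the loops costs the other 2. -/
theorem runsIn_advance (E : Env X) (fl : Bool) (acc : List Bool) (w : Bool) (p : ℕ)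
    (k : X × Bool) : (advance w k).RunsIn (5 * E.count k + 2)
      (E.reading fl acc w p k (E.count k) 0)
      (E.reading fl acc w (p + E.count k) k (E.count k) 0) := by
  have h1 := Prog.RunsIn.loop (k := .ctr k.1 k.2) (t := 2)
    (p := .seq (.op (.move (.ctr k.1 k.2) .tmp)) (.op (.move (.word w) (.read w))))
    (E.count k) (fun i => E.reading fl acc w (p + i) k (E.count k - i) i)
    (fun i hi => by
      obtain ⟨m, hm⟩ : ∃ m, E.count k - i = m + 1 := ⟨E.count k - i - 1, by omega⟩
      have hm' : E.count k - (i + 1) = m := by omega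
      refine ⟨by simp [reading, hm], ?_⟩
      simp only [hm, hm']
      refine Prog.RunsIn.seq (.op (run_move_tmp ..)) (.op ?_)
      rw [run_move_read, add_assoc])
    (by simp [reading])
  have h2 := Prog.RunsIn.loop (k := .tmp) (t := 1) (p := .op (.move .tmp (.ctr k.1 k.2)))
    (E.count k) (fun i => E.reading fl acc w (p + E.count k) k i (E.count k - i))
    (fun i hi => by
      obtain ⟨m, hm⟩ : ∃ m, E.count k - i = m + 1 := ⟨E.count k - i - 1, by omega⟩
      have hm' : E.count k - (i + 1) = m := by omega
      refine ⟨by simp [reading, hm], ?_⟩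
      simp only [hm, hm']
      exact .op (run_move_ctr ..))
    (by simp [reading])
  simp only [Nat.sub_self, Nat.sub_zero, add_zero] at h1 h2
  exact (h1.seq h2).mono (by omega)

theorem runsIn_rewind (E : Env X) (fl : Bool) (acc : List Bool) (w : Bool) (p : ℕ)
    (k : X × Bool) : (Prog.loop (.read w) (.op (.move (.read w) (.word w)))).RunsIn
      (2 * (E.word w).length + 1) (E.reading fl acc w p k (E.count k) 0) (E.mem fl acc) := by
  have h := runsIn_transfer (k := .read w) (k' := .word w) (by simp)
    (E.reading fl acc w p k (E.count k) 0)
  refine (h.mono (by simp [reading])).congr ?_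
  rw [← reading_zero E fl acc w k]
  ext : 1 <;> try rfl
  funext l
  rcases l with w' | w' | ⟨y, b⟩ | _ | _ <;> try rfl
  · by_cases hw : w' = w <;> simp [Function.update_apply, reading, hw]
  · by_cases hw : w' = w <;> simp [reading, hw]

end Env

namespace Fm

variable [DecidableEq X]

/-- The truth value of a formula. -/
def eval : Fm X → Env X → Bool
  | look w addr a, E => decide ((E.word w)[(addr.map E.count).sum]? = some a)
  | neg φ, E => !φ.eval E
  | and φ ψ, E => φ.eval E && ψ.eval E
  | ex x φ, E => (List.range (E.bnd x)).any fun i => φ.eval (E.set x (i + 1))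

/-- A variable is quantified somewhere in the formula. -/
def Binds : Fm X → X → Prop
  | look _ _ _, _ => False
  | neg φ, y => φ.Binds y
  | and φ ψ, y => φ.Binds y ∨ ψ.Binds y
  | ex x φ, y => y = x ∨ φ.Binds y

/-- No variable is quantified twice in a nested way. -/
def WF : Fm X → Prop
  | look _ _ _ => True
  | neg φ => φ.WF
  | and φ ψ => φ.WF ∧ ψ.WF
  | ex x φ => ¬ φ.Binds x ∧ φ.WF

/-- Move to a position and test the letter there. -/
def scan (w : Bool) (a : Letter) : List (X × Bool) → Prog (Stack X) Letter
  | [] => .op (.test (.word w) a)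
  | k :: l => .seq (Env.advance w k) (scan w a l)

/-- The program that evaluates a formula. -/
def check : Fm X → Prog (Stack X) Letter
  | look w addr a => .seq (.op (.flag fun _ => true)) <| .seq (scan w a addr) <|
      .loop (.read w) (.op (.move (.read w) (.word w)))
  | neg φ => .seq φ.check (.op (.flag not))
  | and φ ψ => .seq φ.check <| .seq (.op .save) <| .seq ψ.check (.op (.combine (· && ·)))
  | ex x φ => .seq (.op (.flag fun _ => false)) <|
      .seq (.loop (.ctr x true) <| .seq (.op .save) <|
        .seq (.op (.move (.ctr x true) (.ctr x false))) <| .seq φ.check (.op (.combine (· || ·)))) <|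
      .loop (.ctr x false) (.op (.move (.ctr x false) (.ctr x true)))

open Polynomial in
/-- A bound for the time to evaluate a formula. -/
noncomputable def time : Fm X → ℕ[X]
  -- The second summand covers setting the flag (1), the test (1) and rewinding the word (2X + 1).
  | look _ addr _ => (addr.length : ℕ[X]) * (5 * Polynomial.X + 2) + (2 * Polynomial.X + 3)
  | neg φ => φ.time + 1
  | and φ ψ => φ.time + ψ.time + 2
  -- Each turn adds a save, a move, a combination and the loop test to the evaluation of the body.
  -- The rest is setting the flag, leaving the loop and resetting the counter.
  | ex _ φ => Polynomial.X * (φ.time + 4) + (2 * Polynomial.X + 3)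

theorem runsIn_scan (E : Env X) (acc : List Bool) (w : Bool) (a : Letter)
    (addr : List (X × Bool)) {B : ℕ} (hB : E.Fits B) (p : ℕ) (k : X × Bool) :
    (scan w a addr).RunsIn (addr.length * (5 * B + 2) + 1)
      (E.reading true acc w p k (E.count k) 0)
      (E.reading (decide ((E.word w)[p + (addr.map E.count).sum]? = some a)) acc w
        (p + (addr.map E.count).sum) k (E.count k) 0) := by
  induction addr generalizing p with
  | nil =>
    refine (Prog.RunsIn.op ?_).mono (by simp)
    simp [Op.run, Env.reading]
  | cons k' l ih =>
    have h1 := E.runsIn_advance true acc w p k'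
    rw [E.reading_congr true acc w p k' k, E.reading_congr true acc w _ k' k] at h1
    refine ((h1.seq (ih _)).mono ?_).congr ?_
    · have := hB.count_le k'
      simp only [List.length_cons]
      nlinarith
    · simp [add_assoc]

/-- The program `check` computes the truth value of the formula and restores the memory. -/
theorem runsIn_check (φ : Fm X) (hφ : φ.WF) {E : Env X} {B : ℕ} (hB : E.Fits B)
    (hE : ∀ x, φ.Binds x → E.val x = 0) (fl : Bool) (acc : List Bool) :
    φ.check.RunsIn (φ.time.eval B) (E.mem fl acc) (E.mem (φ.eval E) acc) := by
  induction φ generalizing E fl acc with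
  | look w addr a =>
    -- `reading` needs a counter to refer to, and an empty address offers none.
    rcases addr with _ | ⟨k, l⟩
    · have h1 : (scan w a []).RunsIn 1 (E.mem true acc) (E.mem ((look w [] a).eval E) acc) := by
        refine .op ?_
        simp [Op.run, Env.mem, eval, Env.stk, List.head?_eq_getElem?]
      refine ((E.runsIn_flag _ fl acc).seq (h1.seq (.loop_nil rfl))).mono ?_
      simp [time]
    · have h1 := runsIn_scan E acc w a (k :: l) hB 0 k
      rw [E.reading_zero, zero_add] at h1
      refine ((E.runsIn_flag _ fl acc).seq (h1.seq (E.runsIn_rewind _ acc w _ k))).mono ?_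
      have := hB.1 w
      simp only [time, Polynomial.eval_add, Polynomial.eval_mul, Polynomial.eval_natCast,
        Polynomial.eval_ofNat, Polynomial.eval_X, Nat.cast_id]
      omega
  | neg φ ih =>
    refine ((ih hφ hB hE fl acc).seq (E.runsIn_flag _ _ acc)).mono ?_
    simp [time]
  | and φ ψ ih ih' =>
    refine ((ih hφ.1 hB (fun x hx => hE x (.inl hx)) fl acc).seq <|
      (E.runsIn_save _ acc).seq <| (ih' hφ.2 hB (fun x hx => hE x (.inr hx)) _ _).seq <|
      E.runsIn_combine _ _ _ acc).mono ?_
    simp only [time, Polynomial.eval_add, Polynomial.eval_ofNat]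
    omega
  | ex x φ ih =>
    have h0 : E.set x 0 = E := Env.set_eq_self (hE x (.inl rfl))
    -- Loop invariant: after `i` turns the flag holds the disjunction over the values 1, …, `i`. It
    -- is saved while the body is evaluated.
    let b : ℕ → Bool := fun i => (List.range i).any fun i => φ.eval (E.set x (i + 1))
    have h1 := Prog.RunsIn.loop (k := .ctr x true) (t := φ.time.eval B + 3)
      (p := .seq (.op .save) <| .seq (.op (.move (.ctr x true) (.ctr x false))) <|
        .seq φ.check (.op (.combine (· || ·))))
      (E.bnd x) (fun i => (E.set x i).mem (b i) acc)
      (fun i hi => by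
        refine ⟨by simp [Env.mem, Env.stk, Env.count, Env.set]; omega, ?_⟩
        have h := ih hφ.2 (hB.set (x := x) (i := i + 1) (by omega))
          (fun y hy => by
            have hyx : y ≠ x := by rintro rfl; exact hφ.1 hy
            simpa [Env.set, hyx] using hE y (.inr hy)) (b i) (b i :: acc)
        refine (((Env.runsIn_save _ _ acc).seq <| (Prog.RunsIn.op
          (E.run_move_succ x hi _ _)).seq <| h.seq <| Env.runsIn_combine _ _ _ _ acc).mono
          (by omega)).congr ?_
        simp [b, List.range_succ])
      (by simp [Env.mem, Env.stk, Env.count, Env.set])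
    have h2 := E.runsIn_reset x le_rfl (b (E.bnd x)) acc
    simp only [h0] at h1 h2
    refine ((E.runsIn_flag (fun _ => false) fl acc).seq (h1.seq h2)).mono ?_
    have hx := (hB.2 x).2
    simp only [time, Polynomial.eval_add, Polynomial.eval_mul, Polynomial.eval_ofNat,
      Polynomial.eval_X]
    have : E.bnd x * (φ.time.eval B + 3 + 1) ≤ B * (φ.time.eval B + 4) :=
      Nat.mul_le_mul_right _ hx
    omega

end Fm

end Fm

/-! ### Reading the encoding of a hypergraph -/

section Encoding

/-- The characteristic vectors of the hyperedges, with a separator at both ends of each. -/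
def edgeWord {n : ℕ} (l : List (Finset (Fin n))) : List Letter :=
  none :: l.flatMap fun e => (List.ofFn fun v : Fin n => some (decide (v ∈ e))) ++ [none]

theorem edgeWord_cons {n : ℕ} (e : Finset (Fin n)) (l : List (Finset (Fin n))) :
    edgeWord (e :: l) =
      none :: ((List.ofFn fun v : Fin n => some (decide (v ∈ e))) ++ edgeWord l) := by
  simp [edgeWord]

theorem Input.encode_eq (I : Input) :
    I.encode = List.replicate I.n (some true) ++ edgeWord I.edgeList := by
  simp [Input.encode, edgeWord]

/-- Since `x + 1 ≤ n`, an offset from a separator stays within the characteristic vector that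
follows it; after the last separator there is nothing to read. -/
theorem exists_edgeWord_iff {n : ℕ} (l : List (Finset (Fin n))) (x y : Fin n) :
    (∃ i : ℕ, (edgeWord l)[i]? = some none ∧ (edgeWord l)[i + (x + 1)]? = some (some true) ∧
      (edgeWord l)[i + (y + 1)]? = some (some true)) ↔ ∃ e ∈ l, x ∈ e ∧ y ∈ e := by
  induction l with
  | nil =>
    simp only [List.not_mem_nil, false_and, exists_false, iff_false]
    rintro ⟨i, -, h, -⟩
    simp [edgeWord, ← add_assoc] at h
  | cons e l ih =>
    rw [edgeWord_cons]
    have hbit : ∀ z : Fin n, ((List.ofFn fun v : Fin n => some (decide (v ∈ e))) ++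
        edgeWord l)[(z : ℕ)]? = some (some (decide (z ∈ e))) := by
      intro z
      rw [List.getElem?_append_left (by simp)]
      simp
    simp only [List.exists_mem_cons_iff, ← ih]
    constructor
    · rintro ⟨i, h1, h2, h3⟩
      cases i with
      | zero =>
        simp only [zero_add, List.getElem?_cons_succ, hbit, Option.some.injEq,
          decide_eq_true_eq] at h2 h3
        exact .inl ⟨h2, h3⟩
      | succ i =>
        right
        rw [Nat.add_right_comm, List.getElem?_cons_succ] at h2 h3
        rw [List.getElem?_cons_succ] at h1
        rcases lt_or_ge i n with hi | hi
        · rw [show i = ((⟨i, hi⟩ : Fin n) : ℕ) from rfl, hbit] at h1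
          simp at h1
        · rw [List.getElem?_append_right (by simp; omega)] at h1 h2 h3
          simp only [List.length_ofFn] at h1 h2 h3
          refine ⟨i - n, h1, ?_, ?_⟩
          · rwa [show i - n + (x + 1) = i + (x + 1) - n by omega]
          · rwa [show i - n + (y + 1) = i + (y + 1) - n by omega]
    · rintro (⟨h1, h2⟩ | ⟨i, h1, h2, h3⟩)
      · refine ⟨0, rfl, ?_, ?_⟩ <;> simp only [zero_add, List.getElem?_cons_succ, hbit] <;> simpa
      · refine ⟨n + i + 1, ?_, ?_, ?_⟩
        · rw [List.getElem?_cons_succ, List.getElem?_append_right (by simp)]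
          simpa using h1
        · rw [Nat.add_right_comm, List.getElem?_cons_succ,
            List.getElem?_append_right (by simp; omega)]
          simpa [add_assoc] using h2
        · rw [Nat.add_right_comm, List.getElem?_cons_succ,
            List.getElem?_append_right (by simp; omega)]
          simpa [add_assoc] using h3

variable (I : Input)

/-- Two numbers of vertices are compared by looking at a position of the word. -/
theorem Input.getElem?_encode_eq_none_iff {i j : ℕ} (hi : i ≤ I.n) (hj : 1 ≤ j)
    (hj' : j ≤ I.n) : I.encode[i + (I.n - j)]? = some none ↔ i = j := by
  rw [I.encode_eq]
  rcases lt_trichotomy i j with h | h | h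
  · rw [List.getElem?_append_left (by simp; omega), List.getElem?_replicate]
    simp [h.ne]
  · subst h
    rw [List.getElem?_append_right (by simp; omega)]
    simp [show i + (I.n - i) = I.n by omega, edgeWord]
  · rw [List.getElem?_append_right (by simp; omega), List.length_replicate]
    simp only [h.ne', iff_false]
    -- Because `j ≥ 1`, `k` is less than `n`: the position falls on a bit of the first hyperedge, or
    -- outside the word if there is none.
    obtain ⟨k, hk⟩ : ∃ k, i + (I.n - j) - I.n = k + 1 := ⟨i - j - 1, by omega⟩
    rw [hk]
    rcases I.edgeList with _ | ⟨e, l⟩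
    · simp [edgeWord]
    · rw [edgeWord_cons, List.getElem?_cons_succ, List.getElem?_append_left (by simp; omega)]
      simp

/-- Two vertices lie in a common hyperedge iff the word contains a separator with the letter 1
at the corresponding distances. -/
theorem Input.exists_getElem?_encode_iff (x y : Fin I.n) :
    (∃ i < I.encode.length, I.encode[i + 1]? = some none ∧
      I.encode[i + 1 + (x + 1)]? = some (some true) ∧
      I.encode[i + 1 + (y + 1)]? = some (some true)) ↔ ∃ e ∈ I.edgeList, x ∈ e ∧ y ∈ e := by
  rw [← exists_edgeWord_iff]
  have hlen : (List.replicate I.n (some true : Letter)).length = I.n := by simp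
  have hx := x.isLt
  constructor
  · rintro ⟨i, -, h1, h2, h3⟩
    rw [I.encode_eq] at h1 h2 h3
    rcases lt_or_ge (i + 1) I.n with hi | hi
    · rw [List.getElem?_append_left (by omega), List.getElem?_replicate] at h1
      simp [hi] at h1
    · rw [List.getElem?_append_right (by omega), hlen] at h1 h2 h3
      refine ⟨i + 1 - I.n, h1, ?_, ?_⟩
      · rwa [show i + 1 - I.n + (x + 1) = i + 1 + (x + 1) - I.n by omega]
      · rwa [show i + 1 - I.n + (y + 1) = i + 1 + (y + 1) - I.n by omega]
  · rintro ⟨i, h1, h2, h3⟩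
    have key : ∀ k, I.encode[I.n + k]? = (edgeWord I.edgeList)[k]? := by
      intro k
      rw [I.encode_eq, List.getElem?_append_right (by omega), hlen, Nat.add_sub_cancel_left]
    -- Quantified values start at 1, so position 0 is out of reach. It is not needed, as `x : Fin
    -- I.n` makes `n` positive.
    obtain ⟨m, hm⟩ : ∃ m, I.n + i = m + 1 := ⟨I.n + i - 1, by omega⟩
    refine ⟨m, ?_, ?_, ?_, ?_⟩
    · by_contra hlt
      have := key i
      rw [h1, List.getElem?_eq_none (by omega)] at this
      simp at this
    · rw [← hm, key, h1]
    · rw [← hm, add_assoc, key, h2]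
    · rw [← hm, add_assoc, key, h3]

theorem Input.lt_length_encode : I.n < I.encode.length := by
  rw [I.encode_eq, edgeWord]
  simp

end Encoding

/-! ### The elimination of candidates as a formula -/

/-- The variables of the program: the number of the round, the candidate under examination,
three more vertices and a position in the input word. -/
inductive Var
  | round
  | d
  | v
  | c
  | z
  | e
  deriving DecidableEq

instance : Fintype Var where
  elems := {.round, .d, .v, .c, .z, .e}
  complete x := by cases x <;> decide

namespace Fm

/-- Disjunction. -/
def or {X : Type} (φ ψ : Fm X) : Fm X := neg (and (neg φ) (neg ψ))

/-- Two vertices are equal. -/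
def equal (x y : Var) : Fm Var := look false [(x, false), (y, true)] none

/-- A vertex lies in the closed neighbourhood of another one. -/
def near (x y : Var) : Fm Var :=
  or (equal x y) <| ex .e <| and (look false [(.e, false)] none) <|
    and (look false [(.e, false), (x, false)] (some true))
      (look false [(.e, false), (y, false)] (some true))

/-- A vertex is a candidate. -/
def cand (x : Var) : Fm Var := look true [(x, false)] (some true)

/-- The candidate `d` is not eliminated. -/
def keep : Fm Var :=
  and (cand .d) <| neg <| ex .v <| neg <| ex .c <| and (cand .c) <| and (near .v .c) <| neg <|
    ex .z <| and (near .z .c) <| and (near .z .d) <| neg (equal .c .d)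

/-- There is a candidate. -/
def nonempty : Fm Var := ex .d (cand .d)

end Fm

open Classical in
/-- The characteristic vector of a set of vertices, after a separator. -/
noncomputable def setWord {n : ℕ} (C : Set (Fin n)) : List Letter :=
  none :: List.ofFn fun v => some (decide (v ∈ C))

open Classical in
theorem getElem?_setWord {n : ℕ} (C : Set (Fin n)) (v : Fin n) :
    (setWord C)[(v : ℕ) + 1]? = some (some (decide (v ∈ C))) := by
  simp [setWord]

/-- The environment stores the input and the set `C` of candidates. -/
structure Stores (E : Env Var) (I : Input) (C : Set (Fin I.n)) : Prop where
  word_false : E.word false = I.encode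
  word_true : E.word true = setWord C
  bnd_e : E.bnd .e = I.encode.length
  bnd : ∀ x, x ≠ .e → x ≠ .round → E.bnd x = I.n

namespace Stores

variable {E : Env Var} {I : Input} {C : Set (Fin I.n)}

theorem set (h : Stores E I C) (x : Var) (i : ℕ) : Stores (E.set x i) I C :=
  ⟨h.word_false, h.word_true, h.bnd_e, h.bnd⟩

theorem eval_cand (h : Stores E I C) {x : Var} {u : Fin I.n} (hx : E.val x = u + 1) :
    (Fm.cand x).eval E = true ↔ u ∈ C := by
  simp [Fm.cand, Fm.eval, Env.count, hx, h.word_true, getElem?_setWord]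

theorem eval_equal (h : Stores E I C) {x y : Var} {u w : Fin I.n} (hy : E.bnd y = I.n)
    (hu : E.val x = u + 1) (hw : E.val y = w + 1) :
    (Fm.equal x y).eval E = true ↔ u = w := by
  have := I.getElem?_encode_eq_none_iff (i := u + 1) (j := w + 1) (by omega) (by omega) (by omega)
  simp [Fm.equal, Fm.eval, Env.count, hu, hw, hy, h.word_false, this, Fin.ext_iff]

theorem eval_near (h : Stores E I C) {x y : Var} {u w : Fin I.n} (hx : x ≠ .e) (hy : y ≠ .e)
    (hyb : E.bnd y = I.n) (hu : E.val x = u + 1) (hw : E.val y = w + 1) :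
    (Fm.near x y).eval E = true ↔ u ∈ closedNbhd I.toHypergraph.twoSection w := by
  rw [mem_closedNbhd_twoSection, ← h.eval_equal hyb hu hw]
  change _ ↔ _ ∨ ∃ e ∈ I.edgeList, u ∈ e ∧ w ∈ e
  rw [← I.exists_getElem?_encode_iff u w]
  simp [Fm.near, Fm.or, Fm.eval, Env.count, hx, hy, Env.set, hu, hw, h.word_false, h.bnd_e]

/-- Vertex `u` is stored as the value `u + 1`, matching quantifiers that start at 1. The excluded
variables have other bounds. -/
theorem eval_ex (h : Stores E I C) {x : Var} (hx : x ≠ .e) (hx' : x ≠ .round) (φ : Fm Var) :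
    (Fm.ex x φ).eval E = true ↔ ∃ u : Fin I.n, φ.eval (E.set x (u + 1)) = true := by
  simp only [Fm.eval, List.any_eq_true, List.mem_range, h.bnd x hx hx']
  exact ⟨fun ⟨i, hi, h⟩ => ⟨⟨i, hi⟩, h⟩, fun ⟨u, h⟩ => ⟨u, u.isLt, h⟩⟩

theorem eval_nonempty (h : Stores E I C) : Fm.nonempty.eval E = true ↔ C.Nonempty := by
  rw [Fm.nonempty, h.eval_ex (by simp) (by simp)]
  exact exists_congr fun u => (h.set _ _).eval_cand (by simp [Env.set])

theorem eval_and (φ ψ : Fm Var) :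
    (Fm.and φ ψ).eval E = true ↔ φ.eval E = true ∧ ψ.eval E = true := by
  simp [Fm.eval]

theorem eval_neg (φ : Fm Var) : (Fm.neg φ).eval E = true ↔ ¬ φ.eval E = true := by
  simp [Fm.eval]

theorem eval_keep (h : Stores E I C) {u : Fin I.n} (hu : E.val .d = u + 1) :
    Fm.keep.eval E = true ↔ u ∈ refine I.toHypergraph.twoSection C := by
  rw [Fm.keep, eval_and, h.eval_cand hu, eval_neg, h.eval_ex (by simp) (by simp), not_exists]
  refine and_congr Iff.rfl (forall_congr' fun v => ?_)
  have h1 := h.set .v (v + 1)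
  rw [eval_neg, not_not, h1.eval_ex (by simp) (by simp)]
  refine exists_congr fun c => ?_
  have h2 := h1.set .c (c + 1)
  rw [eval_and, h2.eval_cand (u := c) (by simp [Env.set]), eval_and,
    h2.eval_near (u := v) (w := c) (by simp) (by simp) (h2.bnd _ (by simp) (by simp))
      (by simp [Env.set]) (by simp [Env.set]), eval_neg, h2.eval_ex (by simp) (by simp),
    not_exists]
  refine and_congr Iff.rfl (and_congr Iff.rfl (forall_congr' fun z => ?_))
  have h3 := h2.set .z (z + 1)
  rw [eval_and, eval_and, eval_neg,
    h3.eval_near (u := z) (w := c) (by simp) (by simp) (h3.bnd _ (by simp) (by simp))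
      (by simp [Env.set]) (by simp [Env.set]),
    h3.eval_near (u := z) (w := u) (by simp) (by simp) (h3.bnd _ (by simp) (by simp))
      (by simp [Env.set]) (by simpa [Env.set] using hu),
    h3.eval_equal (u := c) (w := u) (h3.bnd _ (by simp) (by simp))
      (by simp [Env.set]) (by simpa [Env.set] using hu)]
  tauto

end Stores

/-! ### The program -/

section Clear

variable {K A : Type} [DecidableEq K] [DecidableEq A]

theorem runsIn_drop (k : K) (s : Memory K A) :
    (Prog.loop k (.op (.drop k))).RunsIn (2 * (s.stk k).length + 1) s
      { s with stk := Function.update s.stk k [] } := by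
  induction h : s.stk k generalizing s with
  | nil =>
    have : Function.update s.stk k [] = s.stk := by rw [← h, Function.update_eq_self]
    rw [this]
    exact .loop_nil h
  | cons a l ih =>
    have h2 := ih ((Op.drop k).run s) (by simp [Op.run, h])
    refine ((Prog.RunsIn.loop_cons (by rw [h]; simp) (.op rfl) h2).mono
      (by simp; omega)).congr ?_
    simp [Op.run]

/-- The program that empties all the stacks in a list. -/
def Prog.clear : List K → Prog K A
  | [] => .op (.flag id)
  | k :: l => .seq (.loop k (.op (.drop k))) (clear l)

theorem runsIn_clear (l : List K) (s : Memory K A) {B : ℕ} (hB : ∀ k, (s.stk k).length ≤ B) :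
    (Prog.clear l).RunsIn (l.length * (2 * B + 1) + 1) s
      { s with stk := fun k => if k ∈ l then [] else s.stk k } := by
  induction l generalizing s with
  | nil => exact (Prog.RunsIn.op (by simp [Op.run])).mono (by simp)
  | cons k l ih =>
    refine (((runsIn_drop k s).seq (ih _ fun j => ?_)).mono ?_).congr ?_
    · by_cases h : j = k
      · subst h; simp
      · simpa [h] using hB j
    · have := hB k
      simp only [List.length_cons]
      nlinarith
    · ext : 1 <;> try rfl
      funext j
      by_cases h : j = k
      · subst h; simp
      · simp [h]

end Clear

/-- The environment at the beginning of a round, where `r` rounds are left and the set of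
candidates is `C`; the word under construction is `l`. -/
noncomputable def roundEnv (I : Input) (C : Set (Fin I.n)) (r : ℕ) (l : List Letter) : Env Var where
  word w := if w then setWord C else I.encode
  val _ := 0
  bnd
    | .e => I.encode.length
    | .round => r
    | _ => I.n
  new := l

theorem stores_roundEnv (I : Input) (C : Set (Fin I.n)) (r : ℕ) (l : List Letter) :
    Stores (roundEnv I C r l) I C where
  word_false := rfl
  word_true := rfl
  bnd_e := rfl
  bnd x h h' := by cases x <;> simp_all [roundEnv]

theorem fits_roundEnv (I : Input) (C : Set (Fin I.n)) {r : ℕ} (hr : r ≤ I.n) (l : List Letter) :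
    (roundEnv I C r l).Fits I.encode.length := by
  have := I.lt_length_encode
  refine ⟨fun w => ?_, fun x => ⟨Nat.zero_le _, ?_⟩⟩
  · cases w
    · simp [roundEnv]
    · simp [roundEnv, setWord]; omega
  · cases x <;> simp only [roundEnv] <;> omega

namespace Prog

/-- Read one letter of the input: count it, and as long as only ones have been read, count it as
a vertex and as a candidate. -/
def initStep : Prog (Stack Var) Letter :=
  .seq (.op (.test (.word false) (some true))) <|
  .seq (.ite
    (.seq (.op (.push (.word true) fun _ => some true)) <|
      .seq (.op (.push (.ctr .round true) fun _ => none)) <|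
      .seq (.op (.push (.ctr .d true) fun _ => none)) <|
      .seq (.op (.push (.ctr .v true) fun _ => none)) <|
      .seq (.op (.push (.ctr .c true) fun _ => none)) (.op (.push (.ctr .z true) fun _ => none)))
    (.op (.flag id))) <|
  .seq (.op (.push (.ctr .e true) fun _ => none)) (.op (.move (.word false) (.read false)))

/-- Set up the environment for the first round. -/
def init : Prog (Stack Var) Letter :=
  .seq (.op (.flag fun _ => true)) <|
  .seq (.loop (.word false) initStep) <|
  .seq (.op (.push (.word true) fun _ => none)) <|
  .seq (.loop (.read false) (.op (.move (.read false) (.word false)))) (.op (.flag fun _ => false))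

/-- Examine all vertices. -/
def examine : Prog (Stack Var) Letter :=
  .loop (.ctr .d true) <|
    .seq (.op (.move (.ctr .d true) (.ctr .d false))) <|
    .seq Fm.keep.check <| .seq (.op (.push .new some)) (.op (.flag fun _ => false))

/-- One round of elimination. -/
def round : Prog (Stack Var) Letter :=
  .seq examine <|
  .seq (.loop (.ctr .d false) (.op (.move (.ctr .d false) (.ctr .d true)))) <|
  .seq (.loop (.word true) (.op (.drop (.word true)))) <|
  .seq (.loop .new (.op (.move .new (.word true)))) (.op (.push (.word true) fun _ => none))

/-- The names of the stacks. -/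
def allStacks : List (Stack Var) :=
  [.word false, .word true, .read false, .read true, .tmp, .new,
    .ctr .round false, .ctr .round true, .ctr .d false, .ctr .d true, .ctr .v false, .ctr .v true,
    .ctr .c false, .ctr .c true, .ctr .z false, .ctr .z true, .ctr .e false, .ctr .e true]

/-- The program that decides the ED problem for hypertrees. -/
def main : Prog (Stack Var) Letter :=
  .seq init <|
  .seq (.loop (.ctr .round true) (.seq (.op (.drop (.ctr .round true))) round)) <|
  .seq Fm.nonempty.check <| .seq (.op .save) <| .seq (.op (.flag fun _ => false)) (clear allStacks)

end Prog

theorem Prog.mem_allStacks (k : Stack Var) : k ∈ Prog.allStacks := by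
  rcases k with (_ | _) | (_ | _) | ⟨_ | _, _ | _⟩ | _ | _ <;> simp [Prog.allStacks]

instance : Fintype (Stack Var) := ⟨Prog.allStacks.toFinset, fun k => by simp [Prog.mem_allStacks]⟩

/-- The memory while the input is read: `l` is left, `r` has been read, `m` vertices and `i`
letters have been counted. -/
def initMem (fl : Bool) (l r : List Letter) (m i : ℕ) : Memory (Stack Var) Letter where
  flag := fl
  acc := []
  stk
    | .word false => l
    | .read false => r
    | .word true => List.replicate m (some true)
    | .ctr .e true => List.replicate i none
    | .ctr _ true => List.replicate m none
    | _ => []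

theorem runsIn_initStep_true (l r : List Letter) (m i : ℕ) :
    Prog.initStep.RunsIn 10 (initMem true (some true :: l) r m i)
      (initMem true l (some true :: r) (m + 1) (i + 1)) := by
  refine (Prog.RunsIn.seq (t := 1) (t' := 9) (s' := initMem true (some true :: l) r m i)
    (.op rfl) <| .seq (t := 7) (t' := 2) (s' := initMem true (some true :: l) r (m + 1) i)
    (.ite_true rfl ?_) <| .seq (t := 1) (t' := 1)
      (s' := initMem true (some true :: l) r (m + 1) (i + 1)) (.op ?_) (.op ?_))
  · refine (Prog.RunsIn.seq (t := 1) (t' := 5) (.op rfl) <| .seq (t := 1) (t' := 4) (.op rfl) <|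
      .seq (t := 1) (t' := 3) (.op rfl) <| .seq (t := 1) (t' := 2) (.op rfl) <|
      .seq (t := 1) (t' := 1) (.op rfl) (.op ?_))
    ext : 1 <;> try rfl
    funext j
    rcases j with (_ | _) | (_ | _) | ⟨_ | _, _ | _⟩ | _ | _ <;> rfl
  · ext : 1 <;> try rfl
    funext j
    rcases j with (_ | _) | (_ | _) | ⟨_ | _, _ | _⟩ | _ | _ <;> rfl
  · ext : 1 <;> try rfl
    funext j
    rcases j with (_ | _) | (_ | _) | ⟨_ | _, _ | _⟩ | _ | _ <;> rfl

theorem runsIn_initStep_false (fl : Bool) (a : Letter) (l r : List Letter) (m i : ℕ)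
    (h : (fl && decide (a = some true)) = false) :
    Prog.initStep.RunsIn 10 (initMem fl (a :: l) r m i) (initMem false l (a :: r) m (i + 1)) := by
  refine (Prog.RunsIn.seq (t := 1) (t' := 4) (s' := initMem false (a :: l) r m i)
    (.op ?_) <| .seq (t := 2) (t' := 2) (s' := initMem false (a :: l) r m i)
    (.ite_false rfl (.op rfl)) <| .seq (t := 1) (t' := 1)
      (s' := initMem false (a :: l) r m (i + 1)) (.op ?_) (.op ?_)).mono (by norm_num)
  · simpa [Op.run, initMem] using h
  · ext : 1 <;> try rfl
    funext j
    rcases j with (_ | _) | (_ | _) | ⟨_ | _, _ | _⟩ | _ | _ <;> rfl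
  · ext : 1 <;> try rfl
    funext j
    rcases j with (_ | _) | (_ | _) | ⟨_ | _, _ | _⟩ | _ | _ <;> rfl

/-- Once the first separator has cleared the flag it stays cleared, so ones in characteristic
vectors are not counted as vertices. -/
theorem runsIn_initLoop_false (l r : List Letter) (m i : ℕ) :
    (Prog.loop (.word false) Prog.initStep).RunsIn (11 * l.length + 1) (initMem false l r m i)
      (initMem false [] (l.reverse ++ r) m (i + l.length)) := by
  induction l generalizing r i with
  | nil => exact .loop_nil rfl
  | cons a l ih =>
    refine ((Prog.RunsIn.loop_cons (by simp [initMem])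
      (runsIn_initStep_false false a l r m i rfl) (ih _ _)).mono (by simp; omega)).congr ?_
    simp [add_assoc, add_comm 1]

theorem runsIn_initLoop (n : ℕ) (l r : List Letter) (m i : ℕ) :
    (Prog.loop (.word false) Prog.initStep).RunsIn (11 * (n + (l.length + 1)) + 1)
      (initMem true (List.replicate n (some true) ++ none :: l) r m i)
      (initMem false [] ((List.replicate n (some true) ++ none :: l).reverse ++ r) (m + n)
        (i + (n + (l.length + 1)))) := by
  induction n generalizing r m i with
  | zero =>
    refine ((Prog.RunsIn.loop_cons (by simp [initMem])
      (runsIn_initStep_false true none l r m i rfl) (runsIn_initLoop_false _ _ _ _)).mono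
      (by omega)).congr ?_
    simp [add_assoc, add_comm 1]
  | succ n ih =>
    refine ((Prog.RunsIn.loop_cons (by simp [initMem, List.replicate_succ])
      (by rw [List.replicate_succ]; exact runsIn_initStep_true _ r m i) (ih _ _ _)).mono
      (by omega)).congr ?_
    congr 1
    · simp [List.replicate_succ]
    · omega
    · omega

theorem runsIn_init (I : Input) :
    Prog.init.RunsIn (13 * I.encode.length + 5) (initMem false I.encode [] 0 0)
      ((roundEnv I Set.univ I.n []).mem false []) := by
  obtain ⟨l, hl⟩ : ∃ l, I.encode = List.replicate I.n (some true) ++ none :: l :=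
    ⟨_, by rw [I.encode_eq]; rfl⟩
  have h1 := runsIn_initLoop I.n l [] 0 0
  rw [← hl] at h1
  have hlen : I.n + (l.length + 1) = I.encode.length := by rw [hl]; simp
  rw [hlen] at h1
  simp only [List.append_nil, zero_add] at h1
  refine ((Prog.RunsIn.seq (t := 1) (.op rfl) <| h1.seq <| Prog.RunsIn.seq (t := 1) (.op rfl) <|
    (runsIn_transfer (by simp) _).seq (.op rfl))).mono ?_ |>.congr ?_
  · simp [Op.run, initMem]
    omega
  · ext : 1 <;> try rfl
    funext j
    rcases j with (_ | _) | (_ | _) | ⟨_ | _, _ | _⟩ | _ | _ <;>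
      simp [Op.run, initMem, Env.mem, Env.stk, roundEnv, setWord, Env.count]

/-- `d` is driven by the outer loop of `examine` and is nonzero when `keep` is evaluated, whereas
`runsIn_check` requires quantified variables to be zero. -/
theorem binds_keep (x : Var) (hx : Fm.keep.Binds x) : x ≠ .d := by
  rintro rfl
  simp [Fm.keep, Fm.Binds, Fm.cand, Fm.near, Fm.or, Fm.equal] at hx

theorem wf_keep : Fm.keep.WF := by
  simp [Fm.keep, Fm.WF, Fm.Binds, Fm.cand, Fm.near, Fm.or, Fm.equal]

theorem wf_nonempty : Fm.nonempty.WF := by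
  simp [Fm.nonempty, Fm.WF, Fm.Binds, Fm.cand]

-- The verdicts are pushed one by one, so the word under construction is reversed; the transfer at
-- the end of the round restores the order.
open Classical in
theorem runsIn_examine (I : Input) (C : Set (Fin I.n)) {r : ℕ} (hr : r ≤ I.n) :
    Prog.examine.RunsIn (I.n * (Fm.keep.time.eval I.encode.length + 4) + 1)
      ((roundEnv I C r []).mem false [])
      (((roundEnv I C r (List.ofFn fun v =>
        some (decide (v ∈ refine I.toHypergraph.twoSection C))).reverse).set .d I.n).mem
        false []) := by
  set b : List Letter := List.ofFn fun v =>
    some (decide (v ∈ refine I.toHypergraph.twoSection C)) with hb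
  have h := Prog.RunsIn.loop (k := .ctr .d true) (t := Fm.keep.time.eval I.encode.length + 3)
    (p := .seq (.op (.move (.ctr .d true) (.ctr .d false))) <|
      .seq Fm.keep.check <| .seq (.op (.push .new some)) (.op (.flag fun _ => false)))
    I.n (fun i => ((roundEnv I C r (b.take i).reverse).set .d i).mem false [])
    (fun i hi => by
      refine ⟨by simp [Env.mem, Env.stk, Env.count, Env.set, roundEnv]; omega, ?_⟩
      set E := roundEnv I C r (b.take i).reverse with hE
      have hF : E.Fits I.encode.length := fits_roundEnv I C hr _
      have h1 := Fm.runsIn_check Fm.keep wf_keep (E := E.set .d (i + 1))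
        (hF.set (by simpa [hE, roundEnv] using hi))
        (fun x hx => by simp [Env.set, binds_keep x hx, hE, roundEnv]) false []
      refine ((Prog.RunsIn.op (E.run_move_succ .d (by simpa [hE, roundEnv] using hi) _ _)).seq <|
        h1.seq <| Prog.RunsIn.seq (t := 1) (.op rfl) (.op ?_)).mono (by omega)
      have h2 := ((stores_roundEnv I C r (b.take i).reverse).set .d (i + 1)).eval_keep
        (u := ⟨i, hi⟩) (by simp [Env.set])
      have h3 : b.take (i + 1) = b.take i ++ [some (Fm.keep.eval (E.set .d (i + 1)))] := by
        rw [List.take_add_one]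
        congr 1
        simp only [hb, List.getElem?_ofFn, hi, dif_pos, Option.toList_some]
        rw [← hE] at h2
        simp [← h2]
      ext : 1 <;> try rfl
      funext j
      rcases j with (_ | _) | (_ | _) | ⟨_ | _, _ | _⟩ | _ | _ <;>
        simp [Op.run, Env.mem, Env.stk, Env.set, Env.count, hE, roundEnv, h3])
    (by simp [Env.mem, Env.stk, Env.count, Env.set, roundEnv])
  have h0 : (roundEnv I C r []).set .d 0 = roundEnv I C r [] := Env.set_eq_self rfl
  have h4 : b.take I.n = b := List.take_of_length_le (by simp [hb])
  simp only [List.take_zero, List.reverse_nil, h0, h4] at h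
  exact h

/-- Besides the examination, resetting `d`, dropping the old word of length n + 1 and moving the new
one cost 2n + 1, 2n + 3 and 2n + 1 steps; the separator costs 1. -/
theorem runsIn_round (I : Input) (C : Set (Fin I.n)) {r : ℕ} (hr : r ≤ I.n) :
    Prog.round.RunsIn (I.n * (Fm.keep.time.eval I.encode.length + 10) + 7)
      ((roundEnv I C r []).mem false [])
      ((roundEnv I (refine I.toHypergraph.twoSection C) r []).mem false []) := by
  classical
  have h1 := runsIn_examine I C hr
  set E := roundEnv I C r (List.ofFn fun v =>
    (some (decide (v ∈ refine I.toHypergraph.twoSection C)) : Letter)).reverse with hE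
  have h2 := E.runsIn_reset .d (i := I.n) (by simp [hE, roundEnv]) false []
  rw [Env.set_eq_self (i := 0) rfl] at h2
  refine ((h1.seq <| h2.seq <| (runsIn_drop (.word true) _).seq <|
    (runsIn_transfer (k := .new) (k' := .word true) (by simp) _).seq (.op rfl)).mono ?_).congr ?_
  · simp [Env.mem, Env.stk, hE, roundEnv, setWord]
    nlinarith
  · ext : 1 <;> try rfl
    funext j
    rcases j with (_ | _) | (_ | _) | ⟨_ | _, _ | _⟩ | _ | _ <;>
      simp [Op.run, Env.mem, Env.stk, Env.count, hE, roundEnv, setWord]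

theorem runsIn_rounds (I : Input) :
    (Prog.loop (.ctr .round true) (.seq (.op (.drop (.ctr .round true))) Prog.round)).RunsIn
      (I.n * (I.n * (Fm.keep.time.eval I.encode.length + 10) + 9) + 1)
      ((roundEnv I Set.univ I.n []).mem false [])
      ((roundEnv I ((refine I.toHypergraph.twoSection)^[I.n] Set.univ) 0 []).mem false []) := by
  have h := Prog.RunsIn.loop (k := .ctr .round true)
    (t := I.n * (Fm.keep.time.eval I.encode.length + 10) + 8)
    (p := .seq (.op (.drop (.ctr .round true))) Prog.round)
    I.n (fun i => (roundEnv I ((refine I.toHypergraph.twoSection)^[i] Set.univ)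
      (I.n - i) []).mem false [])
    (fun i hi => by
      refine ⟨by simp [Env.mem, Env.stk, Env.count, roundEnv]; omega, ?_⟩
      have h1 := runsIn_round I ((refine I.toHypergraph.twoSection)^[i] Set.univ)
        (r := I.n - (i + 1)) (by omega)
      rw [← Function.iterate_succ_apply' (refine I.toHypergraph.twoSection)] at h1
      refine (Prog.RunsIn.seq (.op ?_) h1).mono (by omega)
      ext : 1 <;> try rfl
      funext j
      rcases j with (_ | _) | (_ | _) | ⟨_ | _, _ | _⟩ | _ | _ <;>
        simp [Op.run, Env.mem, Env.stk, Env.count, roundEnv, Nat.sub_sub])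
    (by simp [Env.mem, Env.stk, Env.count, roundEnv])
  simpa using h

open Polynomial in
/-- A bound for the running time of the program. -/
noncomputable def mainTime : ℕ[X] :=
  -- The 2 pays for saving the answer and clearing the flag; 18 is the number of stacks to empty.
  (13 * X + 5) + (X * (X * (Fm.keep.time + 10) + 9) + 1) + Fm.nonempty.time + 2 +
    (18 * (2 * X + 1) + 1)

/-- The memory at the end, with the answer on the stack of saved flags. -/
def Memory.answer (b : Bool) : Memory (Stack Var) Letter := ⟨false, [b], fun _ => []⟩

-- A halting configuration with output must have the initial register and nothing but the output on
-- its stacks. This is why the answer goes to the saved flags and all else is cleared.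
open Classical in
theorem runsIn_main (I : Input) :
    Prog.main.RunsIn (mainTime.eval I.encode.length) (initMem false I.encode [] 0 0)
      (Memory.answer
        (decide ((refine I.toHypergraph.twoSection)^[I.n] Set.univ).Nonempty)) := by
  have h1 := runsIn_init I
  have h2 := runsIn_rounds I
  set C := (refine I.toHypergraph.twoSection)^[I.n] Set.univ
  have hF := fits_roundEnv I C (Nat.zero_le _) []
  have h3 := Fm.runsIn_check Fm.nonempty wf_nonempty hF (fun _ _ => rfl) false []
  have h4 : Fm.nonempty.eval (roundEnv I C 0 []) = decide C.Nonempty := by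
    rw [Bool.eq_iff_iff, (stores_roundEnv I C 0 []).eval_nonempty, decide_eq_true_eq]
  rw [h4] at h3
  set E := roundEnv I C 0 []
  have h5 := runsIn_clear Prog.allStacks (E.mem false [decide C.Nonempty]) (B := I.encode.length)
    (fun k => by
      rcases k with w | w | ⟨x, b⟩ | _ | _
      · exact hF.1 w
      · simp [Env.mem, Env.stk]
      · simpa [Env.mem, Env.stk] using hF.count_le (x, b)
      · simp [Env.mem, Env.stk]
      · simp [Env.mem, Env.stk, E, roundEnv])
  refine ((h1.seq <| h2.seq <| h3.seq <| (E.runsIn_save _ []).seq <|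
    (E.runsIn_flag (fun _ => false) _ _).seq h5).mono ?_).congr ?_
  · have hn := I.lt_length_encode.le
    have hm : I.n * (I.n * (Fm.keep.time.eval I.encode.length + 10) + 9) ≤ I.encode.length *
        (I.encode.length * (Fm.keep.time.eval I.encode.length + 10) + 9) := by gcongr
    simp only [mainTime, Polynomial.eval_add, Polynomial.eval_mul, Polynomial.eval_ofNat,
      Polynomial.eval_X, Polynomial.eval_one, Prog.allStacks, List.length_cons, List.length_nil]
    omega
  · simp [Memory.answer, Prog.mem_allStacks, Env.mem]

/-! ### The machine -/

/-- The multi-stack machine that decides the ED problem for hypertrees. -/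
noncomputable def edMachine : FinTM2 where
  K := Option (Stack Var)
  k₀ := some (.word false)
  k₁ := none
  Γ := StackAlphabet (Stack Var) Letter
  -- The additional label is the exit of the main program, where the machine halts.
  Λ := Option Prog.main.Label
  main := some Prog.main.start
  ΛFin := Fintype.ofFinite _
  σ := Register Letter
  initialState := (false, none)
  Γk₀Fin := inferInstanceAs (Fintype (Option Bool))
  m
    | some l => Prog.main.code some none l
    | none => .halt

theorem initList_edMachine (l : List Letter) :
    initList edMachine l = (initMem false l [] 0 0).cfg (some (some Prog.main.start)) := by
  refine congrArg (TM2.Cfg.mk _ _) ?_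
  funext k
  rcases k with _ | (_ | _) | (_ | _) | ⟨_ | _, _ | _⟩ | _ | _ <;> rfl

theorem haltList_edMachine (b : Bool) :
    haltList edMachine [b] = (Memory.answer b).cfg none := by
  refine congrArg (TM2.Cfg.mk _ _) ?_
  funext k
  rcases k with _ | k
  · rfl
  · rfl

theorem iterate_step_edMachine (I : Input) (hI : I.toHypergraph.IsHypertree) :
    ∃ t ≤ mainTime.eval I.encode.length + 1,
      (flip bind edMachine.step)^[t] (some (initList edMachine I.encode)) =
        some (haltList edMachine [efficientDominationProblem ⟨I, hI⟩]) := by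
  classical
  obtain ⟨t, ht, h⟩ := runsIn_main I
  have h1 := h.iterate_step (M := edMachine.m) (emb := some) (exit := none) fun l => rfl
  -- The extra step executes the halt statement at the exit label.
  refine ⟨t + 1, by omega, ?_⟩
  have h2 : efficientDominationProblem ⟨I, hI⟩ =
      decide ((refine I.toHypergraph.twoSection)^[I.n] Set.univ).Nonempty := by
    have := hI.exists_isEfficientDominating_iff
    rw [Fintype.card_fin] at this
    unfold efficientDominationProblem
    rw [Bool.eq_iff_iff, decide_eq_true_eq, decide_eq_true_eq]
    exact this
  rw [initList_edMachine, haltList_edMachine, h2, Function.iterate_succ_apply']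
  exact (congrArg (flip bind edMachine.step) h1).trans rfl

/-- The ED problem for hypertrees is solvable in polynomial time. -/
noncomputable def edComputableInPolyTime :
    TM2ComputableInPolyTime HypertreeInput.encode Computability.encodeBool
      efficientDominationProblem where
  tm := edMachine
  inputAlphabet := Equiv.refl _
  outputAlphabet := Equiv.refl _
  time := mainTime + 1
  outputsFun I :=
    { steps := (iterate_step_edMachine I.1 I.2).choose
      evals_in_steps := by
        have h := (iterate_step_edMachine I.1 I.2).choose_spec.2
        refine Eq.trans ?_ h
        congr 2
        exact congrArg _ (List.map_id _)
      steps_le_m := by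
        have h := (iterate_step_edMachine I.1 I.2).choose_spec.1
        rw [Polynomial.eval_add, Polynomial.eval_one]
        exact h }

end HypertreeED

theorem mainTheorem4 :
    (∀ (V : Type*) [Fintype V] (H : HypertreeED.MultiHypergraph V),
      H.IsHypertree → HypertreeED.IsDuallyChordal H.twoSection) ∧
    Nonempty (Turing.TM2ComputableInPolyTime
      HypertreeED.HypertreeInput.encode Computability.encodeBool
      HypertreeED.efficientDominationProblem) :=
  ⟨fun _ _ _ h => h.isDuallyChordal, ⟨HypertreeED.edComputableInPolyTime⟩⟩
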